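/- **Setting.** Let $\Gamma\subset\mathbb C$ be a bounded oriented contour consisting of finitely many smooth arcs $\Gamma_i$ (smooth and regular up to the endpoints) and smooth closed curves, which meet only at endpoints of arcs. Functions on $\Gamma$ take values in $\mathbb C^{2\times2}$ (with the operator norm), $D=d/dz$ denotes the weak derivative along each component, $H^k(\Gamma)$ and $W^{k,\infty}(\Gamma)$ are the Sobolev spaces of functions with $D^jf$, $0\le j\le k$, in $L^2(\Gamma)$ resp. $L^\infty(\Gamma)$ (with respect to arc length), and $H^1_z(\Gamma)\subset H^1(\Gamma)$ consists of the $f$ such that at every endpoint $a$ the limits of $f$ at $a$ along the arcs ending at $a$, with sign $-$ for arcs oriented outward and $+$ for arcs oriented inward, sum to $0$. Let $\mathcal C_\Gamma u(z)=\frac1{2\pi i}\int_\Gamma\frac{u(s)}{s-z}\,ds$ and let $\mathcal C_\Gamma^{\pm}u$ be its non-tangential boundary values from the left ($+$) and right ($-$). For a jump matrix $G$ put $$\mathcal T[G;\Gamma]u=\mathcal C_\Gamma^-u\,(G-I),\qquad \mathcal C[G;\Gamma]u=u-\mathcal C_\Gamma^-u\,(G-I).$$ For $k\ge1$, $[G;\Gamma]$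 is *$k$-regular* if $G$ is invertible a.e., $G-I,\ G^{-1}-I\in W^{k,\infty}(\Gamma)\cap H^k(\Gamma)$, and at every endpoint $a$ the product, in counter-clockwise order over the arcs ending at $a$, of the $(k-1)$th-order Taylor expansions at $a$ of $G|_{\Gamma_i}$ (arc oriented outward) or $(G|_{\Gamma_i})^{-1}$ (oriented inward) is $I+\mathcal O((z-a)^k)$. A *numerical method* consists of finite rank projections $\mathcal I_n$ of $H^1(\Gamma)$ and $\mathcal P_n$ of $H^1_z(\Gamma)$, with ranges $Y_n=\operatorname{ran}\mathcal I_n$ and $X_n=\operatorname{ran}\mathcal P_n$, both normed by $L^2(\Gamma)$. Put $\mathcal C_n[G;\Gamma]=\mathcal I_n\mathcal C[G;\Gamma]:X_n\to Y_n$ and $\mathcal T_n[G;\Gamma]=\mathcal I_n\mathcal T[G;\Gamma]$. When $\mathcal C_n[G;\Gamma]$ is invertible (bijective), put $u_n=\mathcal C_n[G;\Gamma]^{-1}\mathcal I_n(G-I)$ and call $\Phi_n=I+\mathcal C_\Gamma u_n$ the approximate solution of $[G;\Gamma]$. The method is *admissible of type $(\alpha,\beta,\gamma)$* for $[G;\Gamma]$,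 where $\alpha,\beta,\gamma\ge0$, if there are constants $C_1,C_2,C_3>0$ such that * for all $n\ge1$ and all jumps $J$ with $J-I\in W^{1,\infty}(\Gamma)\cap H^1(\Gamma)$, $$\|\mathcal C_n[J;\Gamma]\|_{\mathcal L(H^1_z(\Gamma),Y_n)}\le C_1n^\alpha\bigl(1+\|J-I\|_{L^\infty(\Gamma)}\|\mathcal C^-_\Gamma\|_{\mathcal L(L^2(\Gamma))}\bigr),$$ $$\|\mathcal T_n[J;\Gamma]\|_{\mathcal L(X_n,Y_n)}\le C_3n^\gamma\|J-I\|_{L^\infty(\Gamma)}\|\mathcal C^-_\Gamma\|_{\mathcal L(L^2(\Gamma))};$$ * if $\mathcal C[G;\Gamma]$ is invertible on $L^2(\Gamma)$ with bounded inverse, then for all sufficiently large $n$ the operator $\mathcal C_n[G;\Gamma]$ is invertible and $\|\mathcal C_n[G;\Gamma]^{-1}\|_{\mathcal L(Y_n,X_n)}\le C_2n^\beta\|\mathcal C[G;\Gamma]^{-1}\|_{\mathcal L(L^2(\Gamma))}$; * for every $m$ there is $s\ge 1$ with $n^m\|\mathcal I_nu-u\|_{H^1(\Gamma)}\to0$ for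 all $u\in H^s(\Gamma)$ and $n^m\|\mathcal P_nu-u\|_{H^1(\Gamma)}\to0$ for all $u\in H^s(\Gamma)\cap H^1_z(\Gamma)$, as $n\to\infty$; * there is $K$ with $\|\mathcal I_nf\|_{L^2(\Gamma)}\le K\|f\|_{L^\infty(\Gamma)}$ for all $n\ge1$ and $f\in H^1(\Gamma)$. **Lemma.** Let $k\ge1$, let $[G_\xi;\Gamma]$, $\xi\ge0$, and $[G;\Gamma]$ be $k$-regular, let $G_\xi\to G$ in $L^\infty(\Gamma)\cap L^2(\Gamma)$ as $\xi\to\infty$, and let the numerical method be admissible of type $(\alpha,\beta,\gamma)$ for $[G;\Gamma]$. Write $u_{n,\xi},\Phi_{n,\xi}$ and $u_n,\Phi_n$ for the discrete densities and approximate solutions of $[G_\xi;\Gamma]$ and $[G;\Gamma]$. 1. Let $n\ge1$ be such that $\mathcal C_n[G;\Gamma]$ is invertible. Then there is $T(n)>0$ such that $\mathcal C_n[G_\xi;\Gamma]$ is invertible for $\xi>T(n)$. As $\xi\to\infty$ (with $n$ fixed), $u_{n,\xi}\to u_n$ and $\Phi_{n,\xi}^\pm-\Phi_n^\pm\to0$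 in $L^2(\Gamma)$, and $\|\Phi_{n,\xi}-\Phi_n\|_{W^{j,\infty}(S)}\to0$ for all $j\ge0$ and all $S\subset\mathbb C$ bounded away from $\Gamma$. 2. Suppose moreover that $\mathcal C[G;\Gamma]$ is invertible on $L^2(\Gamma)$ with bounded inverse, and put $\delta(\xi)=\|G_\xi-G\|_{L^\infty(\Gamma)}$. Then there are $N$ and $C>0$, independent of $n$ and $\xi$, such that $\mathcal C_n[G;\Gamma]$ is invertible for all $n>N$, and for all $n>N$ and $\xi\ge0$ with $C\,n^{\beta+\gamma}\delta(\xi)\le1$ the operator $\mathcal C_n[G_\xi;\Gamma]$ is invertible and $$\|u_{n,\xi}-u_n\|_{L^2(\Gamma)}\le C\,n^{2\beta+\gamma}\,\delta(\xi).$$ For every $j\ge0$ and $S$ bounded away from $\Gamma$ there is $C'$, independent of $n$ and $\xi$, with $\|\Phi_{n,\xi}-\Phi_n\|_{W^{j,\infty}(S)}\le C'n^{2\beta+\gamma}\,\delta(\xi)$ for the same $n$ and $\xi$. (The quantity $E(\xi)=C_3\|\mathcal C_\Gamma^-\|_{\mathcal L(L^2(\Gamma))}\,\delta(\xi)$ is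 a fixed multiple of $\delta(\xi)$.) -/

import Mathlib

open MeasureTheory Set Filter Topology
open scoped ENNReal ContDiff Matrix.Norms.L2Operator


/-- `2 × 2` complex matrices, with the operator norm of `ℂ²`. -/
abbrev Mat : Type := Matrix (Fin 2) (Fin 2) ℂ

/-- A bounded, oriented, piecewise smooth contour in `ℂ`, decomposed into finitely many smooth
components. Each component is the image of `[0,1]` under a regular smooth parametrization (smooth
up to the endpoints), oriented by increasing parameter. A component is either a smooth closed curve
(`closed i`, and then `γ i` is a smooth `1`-periodic parametrization) or an arc with two ends (the
two ends may coincide). Distinct points of the parameter domain have distinct images, except that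
ends of arcs may meet, and that a closed curve returns to its base point. -/
structure Contour where
  ℓ : ℕ
  γ : Fin ℓ → ℝ → ℂ
  closed : Fin ℓ → Prop
  smooth : ∀ i, ContDiff ℝ ∞ (γ i)
  regular : ∀ i, ∀ t ∈ Icc (0 : ℝ) 1, deriv (γ i) t ≠ 0
  periodic : ∀ i, closed i → Function.Periodic (γ i) 1
  meet : ∀ i j, ∀ s ∈ Icc (0 : ℝ) 1, ∀ t ∈ Icc (0 : ℝ) 1, γ i s = γ j t →
    (i = j ∧ s = t) ∨
      ((s = 0 ∨ s = 1) ∧ (t = 0 ∨ t = 1) ∧ (closed i → i = j) ∧ (closed j → i = j))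

noncomputable section

namespace Contour

variable (Γ : Contour)

/-- Parameter domain of the contour: `(i, t)`, `0 < t < 1`, stands for the point `γ i t`.
A function on `Γ` is represented by its pullback `Γ.Pt → Mat`; only the values at `0 < t < 1`
matter, i.e. the finitely many endpoints are disregarded. -/
abbrev Pt : Type := Fin Γ.ℓ × ℝ

/-- The point set `Γ ⊆ ℂ`. -/
def carrier : Set ℂ := {z | ∃ i, ∃ t ∈ Icc (0 : ℝ) 1, z = Γ.γ i t}

/-- Arc length `|dk|` on `Γ`. -/
def arcLength : Measure Γ.Pt :=
  ((Measure.count : Measure (Fin Γ.ℓ)).prod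
    ((volume : Measure ℝ).restrict (Ioo 0 1))).withDensity fun p => ‖deriv (Γ.γ p.1) p.2‖ₑ

/-- `L²(Γ)`, matrix valued. -/
abbrev L2 : Type := Lp Mat 2 Γ.arcLength

open Classical in
/-- The class of `f` in `L²(Γ)`, if `f` is square integrable. -/
def toL2 (f : Γ.Pt → Mat) : Γ.L2 := if h : MemLp f 2 Γ.arcLength then h.toLp f else 0

/-- The norm of `F` in `L^∞(Γ)`. -/
def linf (F : Γ.Pt → Mat) : ℝ := (eLpNorm F ⊤ Γ.arcLength).toReal

/-! ### Sobolev spaces -/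

/-- Pullbacks of test functions on the component `Γ_i`: smooth functions with compact support in the
open arc, or all smooth functions on a closed curve. -/
def IsTest (i : Fin Γ.ℓ) (φ : ℝ → ℝ) : Prop :=
  ContDiff ℝ ∞ φ ∧ ((HasCompactSupport φ ∧ tsupport φ ⊆ Ioo 0 1) ∨
    (Γ.closed i ∧ Function.Periodic φ 1))

/-- `g = D f` in the weak sense, componentwise, where `D = d/dz` along `Γ`:
`∫_{Γ_i} f φ'(k) dk = - ∫_{Γ_i} g φ(k) dk`. -/
def IsWeakDeriv (f g : Γ.Pt → Mat) : Prop :=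
  Integrable f Γ.arcLength ∧ Integrable g Γ.arcLength ∧
    ∀ i φ, Γ.IsTest i φ →
      ∫ t in Ioo (0 : ℝ) 1, ((deriv φ t : ℝ) : ℂ) • f (i, t) =
        -∫ t in Ioo (0 : ℝ) 1, ((φ t : ℂ) * deriv (Γ.γ i) t) • g (i, t)

/-- `f ∈ W^{k,p}(Γ)`; this is `H^k(Γ)` for `p = 2`. -/
def MemSobolev (p : ℝ≥0∞) (k : ℕ) (f : Γ.Pt → Mat) : Prop :=
  ∃ g : ℕ → Γ.Pt → Mat, g 0 = f ∧ (∀ j ≤ k, MemLp (g j) p Γ.arcLength) ∧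
    ∀ j < k, Γ.IsWeakDeriv (g j) (g (j + 1))

/-- The norm `‖f‖_{L²} + ‖Df‖_{L²}` of `H¹(Γ)`; it is infinite if `f` has no weak derivative. (The
weak derivative is unique almost everywhere, so that the infimum is over equal values.) -/
def h1Norm (f : Γ.Pt → Mat) : ℝ≥0∞ :=
  ⨅ g, ⨅ _ : Γ.IsWeakDeriv f g, eLpNorm f 2 Γ.arcLength + eLpNorm g 2 Γ.arcLength

/-! ### Ends of arcs, junction points -/

/-- The ends of the components: `(i, true)` is the start of `Γ_i` (where it is oriented outward)
and `(i, false)` its terminal point (where it is oriented inward). -/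
abbrev End : Type := Fin Γ.ℓ × Bool

/-- The endpoint in `ℂ`. -/
def endPt (e : Γ.End) : ℂ := Γ.γ e.1 (if e.2 then 0 else 1)

/-- Approach to an end along the arc, up to null sets. -/
def endFilter (e : Γ.End) : Filter ℝ :=
  (if e.2 then 𝓝[>] (0 : ℝ) else 𝓝[<] (1 : ℝ)) ⊓ ae volume

/-- `f` (defined up to null sets) has the limit `v` at the end `e`. -/
def HasTrace (f : Γ.Pt → Mat) (e : Γ.End) (v : Mat) : Prop :=
  Tendsto (fun t => f (e.1, t)) (Γ.endFilter e) (𝓝 v)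

open Classical in
/-- The ends of the non-closed components at the point `a`. -/
def endsAt (a : ℂ) : Finset Γ.End :=
  Finset.univ.filter fun e => ¬ Γ.closed e.1 ∧ Γ.endPt e = a

/-- `f ∈ H¹_z(Γ)`: `f ∈ H¹(Γ)` satisfies the zeroth-order zero-sum condition at every junction point
and vanishes at isolated endpoints. -/
def MemH1z (f : Γ.Pt → Mat) : Prop :=
  Γ.MemSobolev 2 1 f ∧ ∀ a : ℂ, ∃ v : Γ.End → Mat,
    (∀ e ∈ Γ.endsAt a, Γ.HasTrace f e (v e)) ∧
      ∑ e ∈ Γ.endsAt a, (if e.2 then -(v e) else v e) = 0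

/-- The part of the arc close to the end `e`. -/
def branch (e : Γ.End) : Set ℂ :=
  Γ.γ e.1 '' (if e.2 then Ioo 0 (1 / 2) else Ioo (1 / 2) 1)

/-- `L` lists the ends at `a` in counter-clockwise order: on every small circle around `a` one meets
the corresponding arcs in this order. -/
def IsCounterclockwise (a : ℂ) (L : List Γ.End) : Prop :=
  L.Nodup ∧ (∀ e, e ∈ L ↔ e ∈ Γ.endsAt a) ∧
    ∃ r₀ > 0, ∀ r : ℝ, 0 < r → r < r₀ →
      ∃ θ : Fin L.length → ℝ, StrictMono θ ∧ (∀ i j, θ j < θ i + 2 * Real.pi) ∧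
        ∀ i, a + r * Complex.exp (θ i * Complex.I) ∈ Γ.branch (L.get i)

/-- `q`, as a polynomial in `z - a`, is up to order `k - 1` the Taylor expansion of `F` along the
arc at the end `e` at `a`. -/
def IsTaylor (k : ℕ) (F : Γ.Pt → Mat) (e : Γ.End) (q : Polynomial Mat) : Prop :=
  ∃ g : ℕ → Γ.Pt → Mat, g 0 = F ∧ (∀ j, j + 1 < k → Γ.IsWeakDeriv (g j) (g (j + 1))) ∧
    ∀ j < k, Γ.HasTrace (g j) e ((j.factorial : ℂ) • q.coeff j)

/-- `G` satisfies the `(k-1)`th-order product condition: at each point `a`, with `Ĝ = G` on the arcs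
oriented outward and `Ĝ = G⁻¹` on the arcs oriented inward, the product of the Taylor expansions of
the `Ĝ` in counter-clockwise order is `I + O((z - a)^k)`. -/
def ProductCondition (k : ℕ) (G : Γ.Pt → Mat) : Prop :=
  ∀ a : ℂ, ∃ L : List Γ.End, Γ.IsCounterclockwise a L ∧
    ∃ q : Γ.End → Polynomial Mat,
      (∀ e ∈ L, Γ.IsTaylor k (if e.2 then G else fun p => (G p)⁻¹) e (q e)) ∧
      ∀ j < k, (L.map q).prod.coeff j = (1 : Polynomial Mat).coeff j

/-- `[G; Γ]` is `k`-regular. (The product condition for `G⁻¹`, in which the factors appear in the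
opposite order, is equivalent to that for `G`.) -/
def IsRegular (k : ℕ) (G : Γ.Pt → Mat) : Prop :=
  (∀ᵐ p ∂Γ.arcLength, IsUnit (G p).det) ∧
  Γ.ProductCondition k G ∧
  Γ.MemSobolev ⊤ k (fun p => G p - 1) ∧ Γ.MemSobolev 2 k (fun p => G p - 1) ∧
  Γ.MemSobolev ⊤ k (fun p => (G p)⁻¹ - 1) ∧ Γ.MemSobolev 2 k (fun p => (G p)⁻¹ - 1)

/-! ### Cauchy transform and singular integral operator -/

/-- The Cauchy integral `(2πi)⁻¹ ∫_Γ u(s) / (s - z) ds`. -/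
def cauchy (u : Γ.Pt → Mat) (z : ℂ) : Mat :=
  (2 * (Real.pi : ℂ) * Complex.I)⁻¹ •
    ∑ i, ∫ t in Ioo (0 : ℝ) 1, (deriv (Γ.γ i) t / (Γ.γ i t - z)) • u (i, t)

/-- Non-tangential approach to the point `γ i t` of `Γ`, from the left (`left = true`) or from the
right (`left = false`): the supremum, over all apertures, of the neighbourhoods within cones. -/
def nontangential (left : Bool) (p : Γ.Pt) : Filter ℂ :=
  ⨆ m : ℕ, 𝓝[{z | 0 < (if left then 1 else -1) * ((z - Γ.γ p.1 p.2) / deriv (Γ.γ p.1) p.2).im ∧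
    |((z - Γ.γ p.1 p.2) / deriv (Γ.γ p.1) p.2).re| ≤
      m * |((z - Γ.γ p.1 p.2) / deriv (Γ.γ p.1) p.2).im|}] (Γ.γ p.1 p.2)

/-- The boundary values `Φ^+` (`left = true`) and `Φ^-` (`left = false`) on `Γ`. -/
def boundaryValue (left : Bool) (Φ : ℂ → Mat) (p : Γ.Pt) : Mat :=
  limUnder (Γ.nontangential left p) Φ

/-- The operator `𝒞_Γ^-` on `L²(Γ)`. -/
def cauchyMinus (u : Γ.L2) : Γ.L2 := Γ.toL2 (Γ.boundaryValue false (Γ.cauchy u))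

/-- The norm of `𝒞_Γ^-` on `L²(Γ)`. -/
def cauchyMinusNorm : ℝ := sInf {c | 0 ≤ c ∧ ∀ u : Γ.L2, ‖Γ.cauchyMinus u‖ ≤ c * ‖u‖}

/-- `𝒯[G;Γ] u = 𝒞_Γ^- u (G - I)`. -/
def opT (G : Γ.Pt → Mat) (u : Γ.L2) : Γ.L2 :=
  Γ.toL2 fun p => (Γ.cauchyMinus u) p * (G p - 1)

/-- `𝒞[G;Γ] u = u - 𝒞_Γ^- u (G - I)`. -/
def opC (G : Γ.Pt → Mat) (u : Γ.L2) : Γ.L2 := u - Γ.opT G u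

/-- `𝒞[G;Γ]` is invertible on `L²(Γ)`, with bounded inverse. -/
def OpCInvertible (G : Γ.Pt → Mat) : Prop :=
  Function.Bijective (Γ.opC G) ∧ ∃ K : ℝ, ∀ u : Γ.L2, ‖u‖ ≤ K * ‖Γ.opC G u‖

/-- The norm of `𝒞[G;Γ]⁻¹` on `L²(Γ)`. -/
def opCInvNorm (G : Γ.Pt → Mat) : ℝ := sInf {K | 0 ≤ K ∧ ∀ u : Γ.L2, ‖u‖ ≤ K * ‖Γ.opC G u‖}

/-- `S` is bounded away from `Γ`. -/
def BoundedAway (S : Set ℂ) : Prop := ∃ δ > 0, ∀ z ∈ S, ∀ w ∈ Γ.carrier, δ ≤ ‖z - w‖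

end Contour

/-- The norm of `W^{j,∞}(S)` of a holomorphic function near `S`: the largest of the suprema over `S`
of its derivatives of order at most `j`. -/
def wInfNorm (j : ℕ) (S : Set ℂ) (F : ℂ → Mat) : ℝ≥0∞ :=
  ⨆ m ≤ j, ⨆ z ∈ S, ‖iteratedDeriv m F z‖ₑ

/-! ### Numerical methods -/

/-- A pair of sequences of finite rank projections `𝓘_n` of `H¹(Γ)` and `𝓟_n` of `H¹_z(Γ)`.
They are given as linear maps on all of `L²(Γ)`, for which no continuity is required. This is no
restriction, because a finite rank projection of a subspace extends linearly (with the same range);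
and since `𝒞[G;Γ]` maps `H¹_z(Γ)` to `H¹(Γ)` for regular `G`, only the restrictions to
`H¹(Γ)` and `H¹_z(Γ)` enter below. -/
structure NumericalMethod (Γ : Contour) where
  interp : ℕ → Γ.L2 →ₗ[ℂ] Γ.L2
  proj : ℕ → Γ.L2 →ₗ[ℂ] Γ.L2
  interp_idem : ∀ n f, interp n (interp n f) = interp n f
  proj_idem : ∀ n f, proj n (proj n f) = proj n f
  interp_finite : ∀ n, FiniteDimensional ℂ (LinearMap.range (interp n))
  proj_finite : ∀ n, FiniteDimensional ℂ (LinearMap.range (proj n))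
  interp_mem : ∀ n f, Γ.MemSobolev 2 1 (interp n f)
  proj_mem : ∀ n f, Γ.MemH1z (proj n f)

namespace NumericalMethod

variable {Γ : Contour} (M : NumericalMethod Γ)

/-- `X_n = range 𝓟_n`, with the norm of `L²(Γ)`. -/
def X (n : ℕ) : Submodule ℂ Γ.L2 := LinearMap.range (M.proj n)

/-- `Y_n = range 𝓘_n`, with the norm of `L²(Γ)`. -/
def Y (n : ℕ) : Submodule ℂ Γ.L2 := LinearMap.range (M.interp n)

/-- `𝒞_n[G;Γ] = 𝓘_n 𝒞[G;Γ]`. -/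
def opCn (n : ℕ) (G : Γ.Pt → Mat) (u : Γ.L2) : Γ.L2 := M.interp n (Γ.opC G u)

/-- `𝒯_n[G;Γ] = 𝓘_n 𝒯[G;Γ]`. -/
def opTn (n : ℕ) (G : Γ.Pt → Mat) (u : Γ.L2) : Γ.L2 := M.interp n (Γ.opT G u)

/-- `𝒞_n[G;Γ] : X_n → Y_n` is invertible. -/
def OpCnInvertible (n : ℕ) (G : Γ.Pt → Mat) : Prop := BijOn (M.opCn n G) (M.X n) (M.Y n)

/-- The discrete density `u_n = 𝒞_n[G;Γ]⁻¹ 𝓘_n (G - I)`. -/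
def density (n : ℕ) (G : Γ.Pt → Mat) : Γ.L2 :=
  Function.invFunOn (M.opCn n G) (M.X n) (M.interp n (Γ.toL2 fun p => G p - 1))

/-- The approximate solution `Φ_n = I + 𝒞_Γ u_n` of `[G;Γ]`. -/
def approxSolution (n : ℕ) (G : Γ.Pt → Mat) (z : ℂ) : Mat := 1 + Γ.cauchy (M.density n G) z

/-- The approximation `𝒞_n[G;Γ]` to `𝒞[G;Γ]` is of type `(α, β, γ)`. The first and the third bounds,
which control the operator norms as the jump changes, are required of all jumps `J` with
`J - I ∈ W^{1,∞}(Γ) ∩ H¹(Γ)`; the bound of the inverse is required for the given `G` only. -/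
def IsOfType (G : Γ.Pt → Mat) (α β γ : ℝ) : Prop :=
  0 ≤ α ∧ 0 ≤ β ∧ 0 ≤ γ ∧ ∃ C₁ > 0, ∃ C₂ > 0, ∃ C₃ > 0,
    (∀ n : ℕ, 1 ≤ n → ∀ J : Γ.Pt → Mat,
      Γ.MemSobolev ⊤ 1 (fun p => J p - 1) → Γ.MemSobolev 2 1 (fun p => J p - 1) →
      (∀ u : Γ.L2, Γ.MemH1z u → ‖M.opCn n J u‖ ≤ C₁ * (n : ℝ) ^ α *
        (1 + Γ.linf (fun p => J p - 1) * Γ.cauchyMinusNorm) * (Γ.h1Norm u).toReal) ∧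
      (∀ u ∈ M.X n, ‖M.opTn n J u‖ ≤ C₃ * (n : ℝ) ^ γ *
        (Γ.linf (fun p => J p - 1) * Γ.cauchyMinusNorm) * ‖u‖)) ∧
    (Γ.OpCInvertible G → ∃ N : ℕ, ∀ n > N, M.OpCnInvertible n G ∧
      ∀ u ∈ M.X n, ‖u‖ ≤ C₂ * (n : ℝ) ^ β * Γ.opCInvNorm G * ‖M.opCn n G u‖)

/-- The method is admissible for `[G;Γ]`, of type `(α, β, γ)`: it is of this type, the projections
converge faster than any given power of `n` on sufficiently smooth functions, and `𝓘_n` is bounded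
from `C(Γ)` to `L²(Γ)` uniformly in `n`. -/
def IsAdmissible (G : Γ.Pt → Mat) (α β γ : ℝ) : Prop :=
  M.IsOfType G α β γ ∧
  (∀ m : ℕ, ∃ s : ℕ, 1 ≤ s ∧ ∀ u : Γ.L2, Γ.MemSobolev 2 s u →
    Tendsto (fun n : ℕ => (n : ℝ≥0∞) ^ m * Γ.h1Norm (M.interp n u - u : Γ.L2)) atTop (𝓝 0) ∧
    (Γ.MemH1z u →
      Tendsto (fun n : ℕ => (n : ℝ≥0∞) ^ m * Γ.h1Norm (M.proj n u - u : Γ.L2)) atTop (𝓝 0))) ∧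
  ∃ K : ℝ, ∀ n : ℕ, 1 ≤ n → ∀ f : Γ.L2, Γ.MemSobolev 2 1 f → ‖M.interp n f‖ ≤ K * Γ.linf f

end NumericalMethod

end

/-! The jump enters `𝒞_n` affinely: `𝒞_n[G] - 𝒞_n[F] = 𝒯_n[I + (F - G)]`, and on `X_n` the right
side has norm at most `e = C₃ n^γ δ ‖𝒞⁻‖`, where `δ` is the sup norm of `F - G`. Suppose `‖u‖ ≤ A
‖𝒞_n[G] u‖` on `X_n` and `A e ≤ 1/2`. Then `𝒞_n[F]` is injective, hence bijective, since the
bijection `𝒞_n[G]` forces `dim X_n = dim Y_n`. Subtracting the discrete equations gives `𝒞_n[G](u_F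
- u_G) = 𝓘_n(F - G) + 𝒯_n[I + (F - G)] u_F`; absorbing `A e ‖u_F - u_G‖` leaves the bound `2A(‖𝓘_n(F
- G)‖ + e ‖u_G‖)` (`OpCnInvertible.perturb`). For fixed `n`, some `A` exists by finite dimension.
For uniform bounds, `A` is `C₂ n^β` times the norm of `𝒞[G;Γ]⁻¹`, and both `𝓘_n` terms are
controlled by sup norms; since `‖u_G‖` costs a second factor `A`, the rate is `n^(2β+γ) δ`.

Most of the work is to show that `𝒞_n` is linear on `X_n`. `𝒞⁻` is defined through limits and
through classes in `L²`, both with default values, so for `H¹` densities the nontangential limits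
have to exist and be square integrable. An `H¹` function is Hölder continuous of exponent 1/2
(`MemSobolev.exists_holder`). Subtracting its value at a suitable parameter `s` tames the Cauchy
kernel to `O(|t - s|^(-1/2))`, and what remains is a difference of logarithms. This yields the
limits (`exists_tendsto_cauchy`) and a bound by finitely many singularities `|w - z|^(-1/4)`, which
are square integrable along the contour (`memLp_boundaryValue`). Boundedness of `𝒞⁻` on `L²(Γ)` is
not needed: linear maps on the finite dimensional `X_n` are continuous.

Away from the contour the Cauchy integral is controlled by the `L²` norm of the density, and its
derivatives by Cauchy's estimates (`exists_wInfNorm_sub_le`). -/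

namespace Contour

variable (Γ : Contour)

/-! ### Arc length, component by component -/

theorem contDiff_one (i : Fin Γ.ℓ) : ContDiff ℝ 1 (Γ.γ i) := (Γ.smooth i).of_le (by simp)

theorem continuous_γ (i : Fin Γ.ℓ) : Continuous (Γ.γ i) := (Γ.contDiff_one i).continuous

theorem continuous_deriv (i : Fin Γ.ℓ) : Continuous (deriv (Γ.γ i)) :=
  (Γ.contDiff_one i).continuous_deriv le_rfl

theorem measurable_uncurried {E : Type*} [MeasurableSpace E] {f : Fin Γ.ℓ → ℝ → E}
    (hf : ∀ i, Measurable (f i)) : Measurable fun p : Γ.Pt => f p.1 p.2 :=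
  measurable_from_prod_countable_right hf

/-- The parameter interval of each component. -/
noncomputable abbrev unitMeasure : Measure ℝ := (volume : Measure ℝ).restrict (Ioo 0 1)

theorem arcLength_eq_sum : Γ.arcLength = ∑ i, ((unitMeasure.withDensity
    fun t => ‖deriv (Γ.γ i) t‖ₑ).map (Prod.mk i) : Measure Γ.Pt) := by
  have hm : Measurable fun p : Γ.Pt => ‖deriv (Γ.γ p.1) p.2‖ₑ :=
    Γ.measurable_uncurried fun i => (Γ.continuous_deriv i).measurable.enorm
  ext s hs
  rw [arcLength, withDensity_apply _ hs, ← lintegral_indicator hs,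
    lintegral_prod _ (hm.indicator hs).aemeasurable, lintegral_count, tsum_fintype,
    Measure.finsetSum_apply]
  refine Finset.sum_congr rfl fun i _ => ?_
  have hs' : MeasurableSet (Prod.mk i ⁻¹' s) := measurable_prodMk_left hs
  rw [Measure.map_apply measurable_prodMk_left hs, withDensity_apply _ hs',
    ← lintegral_indicator hs']
  rfl

theorem ae_unitMeasure_deriv_ne (i : Fin Γ.ℓ) :
    ∀ᵐ t ∂unitMeasure, ‖deriv (Γ.γ i) t‖ₑ ≠ 0 := by
  filter_upwards [ae_restrict_mem measurableSet_Ioo] with t ht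
  simpa using Γ.regular i t (Ioo_subset_Icc_self ht)

theorem ae_arcLength_iff {P : Γ.Pt → Prop} :
    (∀ᵐ p ∂Γ.arcLength, P p) ↔ ∀ i, ∀ᵐ t ∂unitMeasure, P (i, t) := by
  rw [arcLength_eq_sum, ae_finsetSum_measure_iff]
  simp only [Finset.mem_univ, true_implies]
  refine forall_congr' fun i => ?_
  rw [(measurableEmbedding_prodMk_left i).ae_map_iff,
    ae_withDensity_iff (Γ.continuous_deriv i).measurable.enorm]
  refine ⟨fun h => ?_, fun h => h.mono fun t ht _ => ht⟩
  filter_upwards [h, Γ.ae_unitMeasure_deriv_ne i] with t ht h' using ht h'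

theorem exists_norm_deriv_bounds (i : Fin Γ.ℓ) :
    ∃ c > 0, ∃ C > 0, ∀ t ∈ Icc (0 : ℝ) 1, c ≤ ‖deriv (Γ.γ i) t‖ ∧ ‖deriv (Γ.γ i) t‖ ≤ C := by
  have hc : ContinuousOn (fun t => ‖deriv (Γ.γ i) t‖) (Icc 0 1) :=
    (Γ.continuous_deriv i).norm.continuousOn
  have hne : (Icc (0 : ℝ) 1).Nonempty := ⟨0, by simp⟩
  obtain ⟨a, ha, hamin⟩ := isCompact_Icc.exists_isMinOn hne hc
  obtain ⟨b, hb, hbmax⟩ := isCompact_Icc.exists_isMaxOn hne hc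
  exact ⟨_, norm_pos_iff.2 (Γ.regular i a ha), _, norm_pos_iff.2 (Γ.regular i b hb),
    fun t ht => ⟨hamin ht, hbmax ht⟩⟩

/-- The speed is bounded below on the compact parameter interval, so Lebesgue measure is dominated
by a multiple of arc length. This transfers integrability from `Γ` to each component. -/
theorem exists_map_le_arcLength (i : Fin Γ.ℓ) :
    ∃ c : ℝ≥0∞, c ≠ ⊤ ∧ (unitMeasure.map (Prod.mk i) : Measure Γ.Pt) ≤ c • Γ.arcLength := by
  obtain ⟨c, hc, _, _, h⟩ := Γ.exists_norm_deriv_bounds i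
  have hc' : ENNReal.ofReal c ≠ 0 := by simpa using hc
  refine ⟨(ENNReal.ofReal c)⁻¹, by simpa using hc, ?_⟩
  have h1 : unitMeasure ≤ (ENNReal.ofReal c)⁻¹ •
      unitMeasure.withDensity (fun t => ‖deriv (Γ.γ i) t‖ₑ) := by
    rw [← withDensity_smul _ (Γ.continuous_deriv i).measurable.enorm]
    nth_rewrite 1 [← withDensity_one (μ := unitMeasure)]
    refine withDensity_mono ?_
    filter_upwards [ae_restrict_mem measurableSet_Ioo] with t ht
    have := (h t (Ioo_subset_Icc_self ht)).1
    simp only [Pi.one_apply, Pi.smul_apply, smul_eq_mul]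
    rw [← ENNReal.inv_mul_cancel hc' (by simp)]
    gcongr
    rw [← ofReal_norm]
    exact ENNReal.ofReal_le_ofReal this
  refine (Measure.map_mono h1 measurable_prodMk_left).trans ?_
  rw [Measure.map_smul]
  gcongr
  rw [arcLength_eq_sum]
  exact Finset.single_le_sum (f := fun i => ((unitMeasure.withDensity
    fun t => ‖deriv (Γ.γ i) t‖ₑ).map (Prod.mk i) : Measure Γ.Pt)) (fun _ _ => Measure.zero_le _)
    (Finset.mem_univ i)

theorem _root_.MeasureTheory.MemLp.slice {E : Type*} [NormedAddCommGroup E] {f : Γ.Pt → E}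
    {p : ℝ≥0∞} (hf : MemLp f p Γ.arcLength) (i : Fin Γ.ℓ) :
    MemLp (fun t => f (i, t)) p unitMeasure := by
  obtain ⟨c, hc, h⟩ := Γ.exists_map_le_arcLength i
  exact (measurableEmbedding_prodMk_left i).memLp_map_measure_iff.1 (hf.of_measure_le_smul hc h)

theorem exists_integral_slice_le (i : Fin Γ.ℓ) : ∃ C : ℝ, 0 ≤ C ∧ ∀ u : Γ.L2,
    ∫ t in Ioo (0 : ℝ) 1, ‖u (i, t)‖ ≤ C * ‖u‖ := by
  obtain ⟨c, hc, h⟩ := Γ.exists_map_le_arcLength i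
  have hc2 : c ^ (1 / (2 : ℝ≥0∞).toReal) ≠ ⊤ := by simp [hc]
  refine ⟨(c ^ (1 / (2 : ℝ≥0∞).toReal)).toReal, by positivity, fun u => ?_⟩
  have hu := (Lp.memLp u).slice Γ i
  have e1 : eLpNorm (fun t => u (i, t)) 2 unitMeasure ≤
      c ^ (1 / (2 : ℝ≥0∞).toReal) * eLpNorm u 2 Γ.arcLength := by
    have := (measurableEmbedding_prodMk_left (β := ℝ) i).eLpNorm_map_measure
      (g := (u : Γ.Pt → Mat)) (p := 2) (μ := unitMeasure)
    refine (this.symm.le.trans (eLpNorm_mono_measure _ h)).trans ?_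
    rw [eLpNorm_smul_measure_of_ne_top (by simp)]
    simp
  -- The parameter interval has total mass 1, so the `L¹` norm is at most the `L²` norm.
  have e2 : eLpNorm (fun t => u (i, t)) 1 unitMeasure ≤
      eLpNorm (fun t => u (i, t)) 2 unitMeasure := by
    have : IsProbabilityMeasure unitMeasure := ⟨by simp⟩
    exact eLpNorm_le_eLpNorm_of_exponent_le (by norm_num) hu.1
  rw [integral_norm_eq_lintegral_enorm hu.1, ← eLpNorm_one_eq_lintegral_enorm, Lp.norm_def,
    ← ENNReal.toReal_mul]
  exact ENNReal.toReal_mono (ENNReal.mul_ne_top hc2 (Lp.eLpNorm_ne_top u)) (e2.trans e1)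

theorem memLp_of_slices {E : Type*} [NormedAddCommGroup E] {f : Γ.Pt → E}
    (hf : ∀ i, MemLp (fun t => f (i, t)) 2 unitMeasure) : MemLp f 2 Γ.arcLength := by
  have key : ∀ i, MemLp f 2 ((unitMeasure.withDensity
      fun t => ‖deriv (Γ.γ i) t‖ₑ).map (Prod.mk i) : Measure Γ.Pt) := fun i => by
    obtain ⟨_, _, C, hC, h⟩ := Γ.exists_norm_deriv_bounds i
    rw [(measurableEmbedding_prodMk_left i).memLp_map_measure_iff]
    refine (hf i).of_measure_le_smul (c := ENNReal.ofReal C) (by simp) ?_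
    rw [← withDensity_const]
    refine withDensity_mono ?_
    filter_upwards [ae_restrict_mem measurableSet_Ioo] with t ht
    rw [← ofReal_norm]
    exact ENNReal.ofReal_le_ofReal (h t (Ioo_subset_Icc_self ht)).2
  have h1 : AEStronglyMeasurable f Γ.arcLength := by
    rw [arcLength_eq_sum, ← Measure.sum_fintype]
    exact AEStronglyMeasurable.sum_measure fun i => (key i).1
  refine ⟨h1, (eLpNorm_lt_top_iff_lintegral_rpow_enorm_lt_top (by simp) (by simp)).2 ?_⟩
  rw [arcLength_eq_sum, lintegral_finsetSum_measure]
  exact ENNReal.sum_lt_top.2 fun i _ =>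
    (eLpNorm_lt_top_iff_lintegral_rpow_enorm_lt_top (by simp) (by simp)).1 (key i).2

instance : IsFiniteMeasure Γ.arcLength := by
  have h : MemLp (fun _ => (1 : ℝ)) 2 Γ.arcLength := Γ.memLp_of_slices fun i => memLp_const 1
  rw [memLp_const_iff (by simp) (by simp)] at h
  simp only [one_ne_zero, false_or] at h
  exact ⟨h⟩

/-! ### Sobolev functions -/

variable {Γ}

theorem IsWeakDeriv.congr {f g f' g' : Γ.Pt → Mat} (h : Γ.IsWeakDeriv f g)
    (hf : f =ᵐ[Γ.arcLength] f') (hg : g =ᵐ[Γ.arcLength] g') : Γ.IsWeakDeriv f' g' := by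
  refine ⟨h.1.congr hf, h.2.1.congr hg, fun i φ hφ => ?_⟩
  have hf' := Γ.ae_arcLength_iff.1 hf i
  have hg' := Γ.ae_arcLength_iff.1 hg i
  have e1 := integral_congr_ae (hf'.mono fun t ht => congrArg (((deriv φ t : ℝ) : ℂ) • ·) ht)
  have e2 := integral_congr_ae
    (hg'.mono fun t ht => congrArg (((φ t : ℂ) * deriv (Γ.γ i) t) • ·) ht)
  exact e1.symm.trans ((h.2.2 i φ hφ).trans (congrArg _ e2))

theorem integrable_slice {f : Γ.Pt → Mat} (hf : Integrable f Γ.arcLength) (i : Fin Γ.ℓ) :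
    Integrable (fun t => f (i, t)) unitMeasure :=
  memLp_one_iff_integrable.1 ((memLp_one_iff_integrable.2 hf).slice Γ i)

theorem IsTest.continuous {i : Fin Γ.ℓ} {φ : ℝ → ℝ} (hφ : Γ.IsTest i φ) : Continuous φ :=
  hφ.1.continuous

theorem IsTest.continuous_deriv {i : Fin Γ.ℓ} {φ : ℝ → ℝ} (hφ : Γ.IsTest i φ) :
    Continuous (deriv φ) := hφ.1.continuous_deriv (by simp)

theorem _root_.MeasureTheory.Integrable.continuous_smul_unit {E : Type*} [NormedAddCommGroup E]
    [NormedSpace ℂ E] {f : ℝ → E} (hf : Integrable f unitMeasure) {φ : ℝ → ℂ} (hφ : Continuous φ) :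
    Integrable (fun t => φ t • f t) unitMeasure := by
  obtain ⟨C, hC⟩ := (isCompact_Icc (a := (0 : ℝ)) (b := 1)).exists_bound_of_continuousOn
    hφ.continuousOn
  refine hf.bdd_smul C hφ.aestronglyMeasurable ?_
  filter_upwards [ae_restrict_mem measurableSet_Ioo] with t ht using hC t (Ioo_subset_Icc_self ht)

theorem IsWeakDeriv.sub {f g f' g' : Γ.Pt → Mat} (h : Γ.IsWeakDeriv f g)
    (h' : Γ.IsWeakDeriv f' g') : Γ.IsWeakDeriv (f - f') (g - g') := by
  refine ⟨h.1.sub h'.1, h.2.1.sub h'.2.1, fun i φ hφ => ?_⟩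
  have c1 : Continuous fun t => ((deriv φ t : ℝ) : ℂ) :=
    Complex.continuous_ofReal.comp hφ.continuous_deriv
  have c2 : Continuous fun t => (φ t : ℂ) * deriv (Γ.γ i) t :=
    (Complex.continuous_ofReal.comp hφ.continuous).mul (Γ.continuous_deriv i)
  simp only [Pi.sub_apply, smul_sub]
  rw [integral_sub ((integrable_slice h.1 i).continuous_smul_unit c1)
      ((integrable_slice h'.1 i).continuous_smul_unit c1),
    integral_sub ((integrable_slice h.2.1 i).continuous_smul_unit c2)
      ((integrable_slice h'.2.1 i).continuous_smul_unit c2), h.2.2 i φ hφ, h'.2.2 i φ hφ]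
  abel

theorem MemSobolev.congr {p : ℝ≥0∞} {k : ℕ} {f f' : Γ.Pt → Mat} (h : Γ.MemSobolev p k f)
    (hf : f =ᵐ[Γ.arcLength] f') : Γ.MemSobolev p k f' := by
  obtain ⟨g, rfl, hg, hd⟩ := h
  -- Only the zeroth member of the chain of derivatives is exchanged.
  have key : ∀ j, g j =ᵐ[Γ.arcLength] Function.update g 0 f' j := fun j => by
    rcases eq_or_ne j 0 with rfl | hj
    · simpa using hf
    · simp [Function.update_of_ne hj]
  exact ⟨Function.update g 0 f', by simp, fun j hj => (hg j hj).ae_eq (key j),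
    fun j hj => (hd j hj).congr (key j) (key (j + 1))⟩

theorem MemSobolev.sub {p : ℝ≥0∞} {k : ℕ} {f f' : Γ.Pt → Mat} (h : Γ.MemSobolev p k f)
    (h' : Γ.MemSobolev p k f') : Γ.MemSobolev p k (f - f') := by
  obtain ⟨g, rfl, hg, hd⟩ := h
  obtain ⟨g', rfl, hg', hd'⟩ := h'
  exact ⟨fun j => g j - g' j, rfl, fun j hj => (hg j hj).sub (hg' j hj),
    fun j hj => (hd j hj).sub (hd' j hj)⟩

theorem MemSobolev.mono {p : ℝ≥0∞} {k l : ℕ} {f : Γ.Pt → Mat} (h : Γ.MemSobolev p k f)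
    (hl : l ≤ k) : Γ.MemSobolev p l f := by
  obtain ⟨g, rfl, hg, hd⟩ := h
  exact ⟨g, rfl, fun j hj => hg j (hj.trans hl), fun j hj => hd j (hj.trans_le hl)⟩

theorem MemSobolev.memLp {p : ℝ≥0∞} {k : ℕ} {f : Γ.Pt → Mat} (h : Γ.MemSobolev p k f) :
    MemLp f p Γ.arcLength := by
  obtain ⟨g, rfl, hg, -⟩ := h
  exact hg 0 (Nat.zero_le _)


/-! ### Weakly differentiable functions on an interval -/

section Interval

variable {E : Type*} [NormedAddCommGroup E] [NormedSpace ℂ E]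

theorem integrable_indicator_prod {w : ℝ → E} (hw : Integrable w unitMeasure) {φ : ℝ → ℝ}
    (hφ : Integrable φ unitMeasure) :
    Integrable (Function.uncurry fun t s => φ t • (Iio t).indicator w s)
      (unitMeasure.prod unitMeasure) := by
  have h1 := hφ.smul_prod hw
  have hs : MeasurableSet {p : ℝ × ℝ | p.2 < p.1} := measurableSet_lt measurable_snd measurable_fst
  refine (h1.indicator hs).congr (ae_of_all _ fun p => ?_)
  by_cases h : p.2 < p.1 <;> simp [Function.uncurry, indicator, h]

/-- Fubini replaces integration by parts: the inner integral of `φ'` over `(s, 1)` is `φ 1 - φ s =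
-φ s`. Writing the primitive with an indicator puts both integrals on the fixed interval. -/
theorem integral_deriv_smul_primitive [CompleteSpace E] {w : ℝ → E}
    (hw : Integrable w unitMeasure) {φ : ℝ → ℝ} (hφ : ContDiff ℝ 1 φ) (h1 : φ 1 = 0) :
    ∫ t in Ioo (0 : ℝ) 1, deriv φ t • ∫ s in Ioo (0 : ℝ) 1, (Iio t).indicator w s =
      -∫ t in Ioo (0 : ℝ) 1, φ t • w t := by
  have hc : Continuous (deriv φ) := hφ.continuous_deriv le_rfl
  have hφi : Integrable (deriv φ) unitMeasure :=
    (hc.integrableOn_Icc (a := 0) (b := 1)).mono_set Ioo_subset_Icc_self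
  simp_rw [← integral_smul]
  rw [integral_integral_swap (integrable_indicator_prod hw hφi), ← integral_neg]
  refine setIntegral_congr_fun measurableSet_Ioo fun s hs => ?_
  have e1 : ∀ t, deriv φ t • (Iio t).indicator w s = (Ioi s).indicator (deriv φ) t • w s := by
    intro t
    by_cases h : s < t <;> simp [indicator, h]
  simp only [e1]
  rw [integral_smul_const, setIntegral_indicator measurableSet_Ioi]
  have e2 : Ioo (0 : ℝ) 1 ∩ Ioi s = Ioo s 1 := by
    ext t; simp only [mem_inter_iff, mem_Ioo, mem_Ioi]; exact ⟨fun h => ⟨h.2, h.1.2⟩,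
      fun h => ⟨⟨hs.1.trans h.1, h.2⟩, h.1⟩⟩
  rw [e2, ← integral_Ioc_eq_integral_Ioo, ← intervalIntegral.integral_of_le hs.2.le,
    intervalIntegral.integral_deriv_eq_sub
      (fun t _ => hφ.differentiable one_ne_zero t) (hc.intervalIntegrable _ _), h1]
  simp

/-- To the left of the support of `χ` the primitive has not started to grow; to the right it equals
the total integral, which is zero. -/
theorem tsupport_subset_of_integral_eq_zero {χ : ℝ → ℝ} (hχ : Continuous χ)
    (hs : HasCompactSupport χ) (hsub : tsupport χ ⊆ Ioo 0 1)
    (hint : ∫ t in Ioo (0 : ℝ) 1, χ t = 0) :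
    HasCompactSupport (fun t => ∫ s in (0 : ℝ)..t, χ s) ∧
      tsupport (fun t => ∫ s in (0 : ℝ)..t, χ s) ⊆ Ioo 0 1 := by
  -- The extra point makes the compact set nonempty when `χ = 0`, so that it has a least and a
  -- greatest element.
  have hK : IsCompact (tsupport χ ∪ {1 / 2}) := IsCompact.union hs isCompact_singleton
  have hKs : tsupport χ ∪ {1 / 2} ⊆ Ioo (0 : ℝ) 1 :=
    union_subset hsub (by rintro _ rfl; norm_num)
  obtain ⟨a, ha, hamin⟩ := hK.exists_isLeast ⟨1 / 2, by simp⟩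
  obtain ⟨b, hb, hbmax⟩ := hK.exists_isGreatest ⟨1 / 2, by simp⟩
  have hz : ∀ t, t ∉ Icc a b → χ t = 0 := fun t ht => by
    by_contra h
    have : t ∈ tsupport χ ∪ {1 / 2} := Or.inl (subset_tsupport _ h)
    exact ht ⟨hamin this, hbmax this⟩
  have hint' : ∫ s in (0 : ℝ)..1, χ s = 0 := by
    rw [intervalIntegral.integral_of_le zero_le_one, integral_Ioc_eq_integral_Ioo, hint]
  have hsupp : tsupport (fun t => ∫ s in (0 : ℝ)..t, χ s) ⊆ Icc a b := by
    refine closure_minimal (fun t ht => ?_) isClosed_Icc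
    by_contra hab
    refine ht ?_
    rcases lt_or_ge t a with h | h
    · have e : ∀ s ∈ uIcc 0 t, χ s = 0 := fun s hs => hz s fun hs' => by
        have : s ≤ max 0 t := (le_max_iff.2 (by simpa [uIcc, le_max_iff] using hs.2))
        exact absurd (hs'.1.trans this) (not_le.2 (max_lt (hKs ha).1 h))
      exact (intervalIntegral.integral_congr (g := fun _ => 0) e).trans (by simp)
    · have hbt : b < t := not_le.1 fun h' => hab ⟨h, h'⟩
      have e : ∀ s ∈ uIcc 1 t, χ s = 0 := fun s hs => hz s fun hs' => by
        have : min 1 t ≤ s := by simpa [uIcc] using hs.1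
        exact absurd (this.trans hs'.2) (not_le.2 (lt_min (hKs hb).2 hbt))
      show ∫ s in (0 : ℝ)..t, χ s = 0
      rw [← intervalIntegral.integral_add_adjacent_intervals
        (hχ.intervalIntegrable 0 1) (hχ.intervalIntegrable 1 t), hint', zero_add]
      exact (intervalIntegral.integral_congr (g := fun _ => 0) e).trans (by simp)
  exact ⟨isCompact_Icc.of_isClosed_subset (isClosed_tsupport _) hsupp,
    hsupp.trans fun t ht => ⟨(hKs ha).1.trans_le ht.1, ht.2.trans_lt (hKs hb).2⟩⟩

theorem exists_test_deriv_eq {χ : ℝ → ℝ} (hχ : ContDiff ℝ ∞ χ)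
    (hs : HasCompactSupport χ) (hsub : tsupport χ ⊆ Ioo 0 1)
    (hint : ∫ t in Ioo (0 : ℝ) 1, χ t = 0) :
    ∃ φ : ℝ → ℝ, ContDiff ℝ ∞ φ ∧ HasCompactSupport φ ∧ tsupport φ ⊆ Ioo 0 1 ∧ deriv φ = χ := by
  obtain ⟨h1, h2⟩ := tsupport_subset_of_integral_eq_zero hχ.continuous hs hsub hint
  have hd : ∀ t, HasDerivAt (fun t => ∫ s in (0 : ℝ)..t, χ s) (χ t) t := fun t =>
    intervalIntegral.integral_hasDerivAt_right (hχ.continuous.intervalIntegrable _ _)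
      (hχ.continuous.stronglyMeasurableAtFilter _ _) hχ.continuous.continuousAt
  have hd' : deriv (fun t => ∫ s in (0 : ℝ)..t, χ s) = χ := funext fun t => (hd t).deriv
  exact ⟨_, contDiff_infty_iff_deriv.2 ⟨fun t => (hd t).differentiableAt, hd'.symm ▸ hχ⟩,
    h1, h2, hd'⟩

/-- The du Bois-Reymond argument: fix a bump `ψ` of mass `m > 0`. Subtracting the right multiple of
`ψ` from a test function `g` leaves mean zero, hence the derivative of a test function. So `f` minus
its `ψ`-average annihilates every `g`. -/
theorem ae_eq_const_of_integral_deriv_smul_eq_zero [CompleteSpace E] {f : ℝ → E}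
    (hf : Integrable f unitMeasure)
    (h : ∀ φ : ℝ → ℝ, ContDiff ℝ ∞ φ → HasCompactSupport φ → tsupport φ ⊆ Ioo 0 1 →
      ∫ t in Ioo (0 : ℝ) 1, deriv φ t • f t = 0) :
    ∃ c, ∀ᵐ t ∂unitMeasure, f t = c := by
  obtain ⟨ψ, hψs, hψc, hψ, hψr, hψ1⟩ := exists_contDiff_tsupport_subset (n := ⊤)
    (isOpen_Ioo.mem_nhds (show (1 / 2 : ℝ) ∈ Ioo 0 1 by norm_num))
  have hout : ∀ g : ℝ → ℝ, tsupport g ⊆ Ioo 0 1 → ∫ t in Ioo (0 : ℝ) 1, g t = ∫ t, g t :=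
    fun g hg => setIntegral_eq_integral_of_forall_compl_eq_zero fun t ht =>
      image_eq_zero_of_notMem_tsupport fun h => ht (hg h)
  have hm : 0 < ∫ t in Ioo (0 : ℝ) 1, ψ t := by
    rw [hout ψ hψs]
    exact hψ.continuous.integral_pos_of_hasCompactSupport_nonneg_nonzero hψc
      (fun t => (hψr ⟨t, rfl⟩).1) (x := 1 / 2) (by rw [hψ1]; exact one_ne_zero)
  set m := ∫ t in Ioo (0 : ℝ) 1, ψ t with hmdef
  have hint : ∀ g : ℝ → ℝ, Continuous g → Integrable g unitMeasure := fun g hg =>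
    (hg.integrableOn_Icc (a := 0) (b := 1)).mono_set Ioo_subset_Icc_self
  have hsm : ∀ g : ℝ → ℝ, Continuous g → Integrable (fun t => g t • f t) unitMeasure :=
    fun g hg => by simpa using hf.continuous_smul_unit (Complex.continuous_ofReal.comp hg)
  refine ⟨m⁻¹ • ∫ t in Ioo (0 : ℝ) 1, ψ t • f t, ?_⟩
  set c := m⁻¹ • ∫ t in Ioo (0 : ℝ) 1, ψ t • f t with hc
  have key := isOpen_Ioo.ae_eq_zero_of_integral_contDiff_smul_eq_zero (μ := volume) (E := ℝ)
    (U := Ioo (0 : ℝ) 1) (f := fun t => f t - c)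
    (IntegrableOn.locallyIntegrableOn (hf.sub (integrable_const c))) ?_
  · rw [ae_restrict_iff' measurableSet_Ioo]
    filter_upwards [key] with t ht h' using sub_eq_zero.1 (ht h')
  intro g hg hgc hgs
  have h0 : ∫ t, g t • (f t - c) = ∫ t in Ioo (0 : ℝ) 1, g t • (f t - c) :=
    (setIntegral_eq_integral_of_forall_compl_eq_zero fun t ht => by
      rw [image_eq_zero_of_notMem_tsupport fun h => ht (hgs h), zero_smul]).symm
  set a := ∫ t in Ioo (0 : ℝ) 1, g t with ha
  let χ : ℝ → ℝ := g - (a / m) • ψ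
  have hχ : ContDiff ℝ ∞ χ := hg.sub (hψ.const_smul (a / m))
  have hψc' : HasCompactSupport ((a / m) • ψ) := hψc.smul_left
  have hχs : tsupport χ ⊆ Ioo 0 1 := by
    refine (tsupport_sub g ((a / m) • ψ)).trans (union_subset hgs ?_)
    exact (tsupport_smul_subset_right (fun _ => a / m) ψ).trans hψs
  have hχ0 : ∫ t in Ioo (0 : ℝ) 1, χ t = 0 := by
    simp only [χ, Pi.sub_apply, Pi.smul_apply, smul_eq_mul]
    rw [integral_sub (hint g hg.continuous) ((hint ψ hψ.continuous).const_mul _),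
      integral_const_mul, ← hmdef, ← ha]
    field_simp
    ring
  obtain ⟨φ, hφ, hφc, hφs, hφd⟩ := exists_test_deriv_eq hχ (hgc.sub hψc') hχs hχ0
  have h1 := h φ hφ hφc hφs
  rw [hφd] at h1
  simp only [χ, Pi.sub_apply, Pi.smul_apply, smul_eq_mul, sub_smul, mul_smul] at h1
  have i3 : Integrable (fun t => (a / m) • ψ t • f t) unitMeasure := (hsm ψ hψ.continuous).smul _
  rw [integral_sub (hsm g hg.continuous) i3, integral_smul] at h1
  rw [h0]
  simp only [smul_sub]
  rw [integral_sub (hsm g hg.continuous) ((hint g hg.continuous).smul_const c),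
    integral_smul_const, ← ha, hc, smul_smul, ← div_eq_mul_inv]
  exact h1

/-- A function with weak derivative `w` is, up to a constant, the primitive of `w`. -/
theorem exists_ae_eq_add_primitive [CompleteSpace E] {f w : ℝ → E}
    (hf : Integrable f unitMeasure) (hw : Integrable w unitMeasure)
    (h : ∀ φ : ℝ → ℝ, ContDiff ℝ ∞ φ → HasCompactSupport φ → tsupport φ ⊆ Ioo 0 1 →
      ∫ t in Ioo (0 : ℝ) 1, deriv φ t • f t = -∫ t in Ioo (0 : ℝ) 1, φ t • w t) :
    ∃ c, ∀ᵐ t ∂unitMeasure, f t = c + ∫ s in Ioo (0 : ℝ) 1, (Iio t).indicator w s := by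
  have hW : Integrable (fun t => ∫ s in Ioo (0 : ℝ) 1, (Iio t).indicator w s) unitMeasure := by
    simpa using (integrable_indicator_prod hw (integrable_const (1 : ℝ))).integral_prod_left
  obtain ⟨c, hc⟩ := ae_eq_const_of_integral_deriv_smul_eq_zero (hf.sub hW) fun φ hφ hφc hφs => by
    have hcd : Continuous fun t => ((deriv φ t : ℝ) : ℂ) :=
      Complex.continuous_ofReal.comp (hφ.continuous_deriv (by simp))
    have i1 := hf.continuous_smul_unit hcd
    have i2 := hW.continuous_smul_unit hcd
    simp only [Complex.coe_smul] at i1 i2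
    simp only [Pi.sub_apply, smul_sub]
    rw [integral_sub i1 i2, h φ hφ hφc hφs, integral_deriv_smul_primitive hw
      (hφ.of_le (by simp)) (image_eq_zero_of_notMem_tsupport fun h => (hφs h).2.false), sub_self]
  exact ⟨c, hc.mono fun t ht => sub_eq_iff_eq_add.1 ht⟩

/-- Cauchy–Schwarz against the indicator of `[s, t)`; the Hölder constant is the `L²` norm of `w`.
-/
theorem exists_primitive_holder {w : ℝ → E} (hw : MemLp w 2 unitMeasure) :
    ∃ H, 0 ≤ H ∧ ∀ s t, 0 ≤ s → s ≤ t →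
      ‖(∫ r in Ioo (0 : ℝ) 1, (Iio t).indicator w r) -
        ∫ r in Ioo (0 : ℝ) 1, (Iio s).indicator w r‖ ≤ H * (t - s) ^ (1 / 2 : ℝ) := by
  have hp : IsProbabilityMeasure unitMeasure := ⟨by simp⟩
  have hi : Integrable w unitMeasure := hw.integrable (by norm_num)
  refine ⟨(∫ r in Ioo (0 : ℝ) 1, ‖w r‖ ^ (2 : ℝ)) ^ (1 / 2 : ℝ), by positivity,
    fun s t hs hst => ?_⟩
  rw [← integral_sub (hi.indicator measurableSet_Iio) (hi.indicator measurableSet_Iio)]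
  have e : ∀ r, ‖(Iio t).indicator w r - (Iio s).indicator w r‖ =
      ‖w r‖ * (Ico s t).indicator (fun _ => (1 : ℝ)) r := fun r => by
    by_cases h1 : r < s
    · simp [indicator, h1, h1.trans_le hst]
    · by_cases h2 : r < t <;> simp [indicator, h1, h2, not_lt.1 h1]
  refine (norm_integral_le_integral_norm _).trans ?_
  simp only [e]
  have hind : MemLp ((Ico s t).indicator fun _ => (1 : ℝ)) 2 unitMeasure :=
    (memLp_const 1).indicator measurableSet_Ico
  have := integral_mul_le_Lp_mul_Lq_of_nonneg (μ := unitMeasure) (p := 2) (q := 2)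
    (f := fun r => ‖w r‖) (g := (Ico s t).indicator fun _ => (1 : ℝ))
    ⟨by norm_num, by norm_num, by norm_num⟩ (ae_of_all _ fun r => norm_nonneg _)
    (ae_of_all _ fun r => indicator_nonneg (fun _ _ => zero_le_one) r)
    (by simpa using hw.norm) (by simpa using hind)
  refine this.trans (mul_le_mul_of_nonneg_left (Real.rpow_le_rpow
    (integral_nonneg fun r => Real.rpow_nonneg (indicator_nonneg (fun _ _ => zero_le_one) r) _)
    ?_ (by norm_num)) (by positivity))
  have e2 : ∀ r, (Ico s t).indicator (fun _ => (1 : ℝ)) r ^ (2 : ℝ) =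
      (Ico s t).indicator (fun _ => (1 : ℝ)) r := fun r => by
    by_cases h : r ∈ Ico s t <;> simp [indicator, h]
  simp only [e2]
  rw [integral_indicator measurableSet_Ico, Measure.restrict_restrict measurableSet_Ico]
  simp only [integral_const, smul_eq_mul, mul_one, measureReal_restrict_apply_univ]
  have h3 := measureReal_mono (μ := (volume : Measure ℝ)) (s₂ := Ico s t)
    (inter_subset_left : Ico s t ∩ Ioo (0 : ℝ) 1 ⊆ Ico s t) (by simp)
  simpa [hst] using h3

end Interval

variable {Γ : Contour}

/-- The one-dimensional Sobolev embedding. In the parameter, the weak derivative is `γ'` times the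
derivative along `Γ`, still in `L²` because `γ'` is bounded; `f` is therefore a primitive of an `L²`
function. -/
theorem MemSobolev.exists_holder {f : Γ.Pt → Mat} (h : Γ.MemSobolev 2 1 f) (i : Fin Γ.ℓ) :
    ∃ (v : ℝ → Mat) (H : ℝ), 0 ≤ H ∧ (∀ᵐ t ∂unitMeasure, f (i, t) = v t) ∧
      ∀ s ∈ Icc (0 : ℝ) 1, ∀ t ∈ Icc (0 : ℝ) 1, ‖v t - v s‖ ≤ H * |t - s| ^ (1 / 2 : ℝ) := by
  obtain ⟨g, rfl, hg, hd⟩ := h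
  obtain ⟨hf, hg1, htest⟩ := hd 0 zero_lt_one
  have hfin : IsProbabilityMeasure unitMeasure := ⟨by simp⟩
  have hw : MemLp (fun t => deriv (Γ.γ i) t • g 1 (i, t)) 2 unitMeasure := by
    have h1 := (hg 1 le_rfl).slice Γ i
    obtain ⟨C, hC⟩ := (isCompact_Icc (a := (0 : ℝ)) (b := 1)).exists_bound_of_continuousOn
      (Γ.continuous_deriv i).continuousOn
    refine h1.of_le_mul (c := C) ((Γ.continuous_deriv i).aestronglyMeasurable.smul h1.1) ?_
    filter_upwards [ae_restrict_mem measurableSet_Ioo] with t ht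
    rw [norm_smul]
    gcongr
    exact hC t (Ioo_subset_Icc_self ht)
  obtain ⟨c, hc⟩ := exists_ae_eq_add_primitive (integrable_slice hf i)
    (hw.integrable (by norm_num)) fun φ hφ hφc hφs => by
      have := htest i φ ⟨hφ, Or.inl ⟨hφc, hφs⟩⟩
      simpa only [mul_smul, Complex.coe_smul] using this
  obtain ⟨H, hH, hh⟩ := exists_primitive_holder hw
  refine ⟨_, H, hH, hc, fun s hs t ht => ?_⟩
  rw [add_sub_add_left_eq_sub]
  rcases le_total s t with hst | hst
  · rw [abs_of_nonneg (sub_nonneg.2 hst)]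
    exact hh s t hs.1 hst
  · rw [abs_sub_comm, abs_of_nonneg (sub_nonneg.2 hst), norm_sub_rev]
    exact hh t s ht.1 hst


/-! ### The weakly singular kernel -/

theorem intervalIntegrable_abs_rpow {r : ℝ} (hr : -1 < r) (a b : ℝ) :
    IntervalIntegrable (fun x => |x| ^ r) volume a b := by
  have h1 : ∀ c : ℝ, 0 ≤ c → IntervalIntegrable (fun x => |x| ^ r) volume 0 c := fun c hc =>
    (intervalIntegral.intervalIntegrable_rpow' hr).congr fun x hx => by
      rw [uIoc_of_le hc] at hx
      simp only [abs_of_pos hx.1]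
  have h2 : ∀ c : ℝ, IntervalIntegrable (fun x => |x| ^ r) volume 0 c := fun c => by
    rcases le_total 0 c with hc | hc
    · exact h1 c hc
    · rw [IntervalIntegrable.iff_comp_neg]
      simpa using h1 (-c) (by simpa using hc)
  exact (h2 a).symm.trans (h2 b)

theorem intervalIntegrable_abs_sub_rpow {r : ℝ} (hr : -1 < r) (s a b : ℝ) :
    IntervalIntegrable (fun t => |t - s| ^ r) volume a b := by
  simpa using (intervalIntegrable_abs_rpow hr (a - s) (b - s)).comp_sub_right s

theorem exists_integral_abs_sub_rpow_le {r : ℝ} (hr : -1 < r) : ∃ κ : ℝ, 0 ≤ κ ∧ ∀ a b s : ℝ,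
    0 ≤ a → a ≤ b → b ≤ 1 → s ∈ Icc (0 : ℝ) 1 → ∫ t in a..b, |t - s| ^ r ≤ κ := by
  refine ⟨∫ x in (-1 : ℝ)..1, |x| ^ r, intervalIntegral.integral_nonneg (by norm_num)
    fun x _ => by positivity, fun a b s ha hab hb hs => ?_⟩
  rw [intervalIntegral.integral_comp_sub_right (fun x => |x| ^ r) s]
  exact intervalIntegral.integral_mono_interval (by linarith [hs.2]) (by linarith)
    (by linarith [hs.1]) (ae_of_all _ fun x => by positivity) (intervalIntegrable_abs_rpow hr _ _)

/-! ### The logarithm along a curve -/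

/-- The exponent 1/4 is chosen below 1/2, so that the resulting bound on Cauchy integrals is square
integrable along a curve. -/
theorem abs_log_le {x : ℝ} (hx : 0 < x) : |Real.log x| ≤ x + 4 * x ^ (-(1 / 4) : ℝ) := by
  have h1 := Real.log_le_self hx.le
  have h2 := Real.log_le_rpow_div (inv_nonneg.2 hx.le) (show (0 : ℝ) < 1 / 4 by norm_num)
  rw [Real.log_inv, Real.inv_rpow hx.le, ← Real.rpow_neg hx.le] at h2
  have h3 : 0 < x ^ (-(1 / 4) : ℝ) := by positivity
  exact abs_le.2 ⟨by linarith, by linarith⟩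

theorem norm_clog_le {w : ℂ} (hw : w ≠ 0) :
    ‖Complex.log w‖ ≤ ‖w‖ + 4 * ‖w‖ ^ (-(1 / 4) : ℝ) + Real.pi := by
  refine (Complex.norm_le_abs_re_add_abs_im _).trans ?_
  rw [Complex.log_re, Complex.log_im]
  exact add_le_add (abs_log_le (norm_pos_iff.2 hw)) (Complex.abs_arg_le_pi w)

variable {γ : ℝ → ℂ}

theorem integral_kernel_eq_clog_sub (hγ : ContDiff ℝ 1 γ) {a b : ℝ} (hab : a ≤ b) {z ρ : ℂ}
    (h : ∀ t ∈ Icc a b, ρ * (γ t - z) ∈ Complex.slitPlane) :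
    ∫ t in a..b, deriv γ t / (γ t - z) =
      Complex.log (ρ * (γ b - z)) - Complex.log (ρ * (γ a - z)) := by
  have hne : ∀ t ∈ Icc a b, ρ * (γ t - z) ≠ 0 := fun t ht => Complex.slitPlane_ne_zero (h t ht)
  refine intervalIntegral.integral_eq_sub_of_hasDerivAt (f := fun t => Complex.log (ρ * (γ t - z)))
    (fun t ht => ?_) ?_
  · rw [uIcc_of_le hab] at ht
    have hd : HasDerivAt (fun t => ρ * (γ t - z)) (ρ * deriv γ t) t :=
      (((hγ.differentiable one_ne_zero t).hasDerivAt).sub_const z).const_mul ρ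
    have := hd.clog_real (h t ht)
    rwa [mul_div_mul_left _ _ (left_ne_zero_of_mul (hne t ht))] at this
  · refine ContinuousOn.intervalIntegrable ?_
    rw [uIcc_of_le hab]
    exact (hγ.continuous_deriv le_rfl).continuousOn.div
      (hγ.continuous.continuousOn.sub continuousOn_const)
      fun t ht => right_ne_zero_of_mul (hne t ht)

theorem mul_sub_le_re_sub (hγ : ContDiff ℝ 1 γ) {a b c : ℝ} {ρ : ℂ}
    (h : ∀ t ∈ Icc a b, c ≤ (deriv γ t / ρ).re) {s t z} (hs : s ∈ Icc a b) (ht : t ∈ Icc a b)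
    (hst : s ≤ t) : c * (t - s) ≤ ((γ t - z) / ρ).re - ((γ s - z) / ρ).re := by
  have hd : ∀ t, HasDerivAt (fun t => ((γ t - z) / ρ).re) (deriv γ t / ρ).re t := fun t =>
    Complex.reCLM.hasFDerivAt.comp_hasDerivAt t
      (((hγ.differentiable one_ne_zero t).hasDerivAt.sub_const z).div_const ρ)
  refine (convex_Icc a b).mul_sub_le_image_sub_of_le_deriv
    (fun t _ => (hd t).continuousAt.continuousWithinAt)
    (fun t _ => (hd t).differentiableAt.differentiableWithinAt) (fun t ht => ?_) s hs t ht hst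
  rw [(hd t).deriv]
  exact h t (interior_subset ht)

/-- The component of `γ t - z` in the direction `ρ` increases at rate at least `c`. Take for `s` its
zero, or an end of the interval if it does not change sign. -/
theorem exists_mul_abs_sub_le (hγ : ContDiff ℝ 1 γ) {a b c : ℝ} {ρ : ℂ} (hab : a ≤ b)
    (h : ∀ t ∈ Icc a b, c ≤ (deriv γ t / ρ).re) (z : ℂ) :
    ∃ s ∈ Icc a b, ∀ t ∈ Icc a b, c * |t - s| ≤ ‖γ t - z‖ / ‖ρ‖ := by
  set r : ℝ → ℝ := fun t => ((γ t - z) / ρ).re with hr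
  have hmono : ∀ s ∈ Icc a b, ∀ t ∈ Icc a b, s ≤ t → c * (t - s) ≤ r t - r s :=
    fun s hs t ht hst => mul_sub_le_re_sub hγ h hs ht hst
  have hcont : Continuous r :=
    Complex.continuous_re.comp ((hγ.continuous.sub continuous_const).div_const ρ)
  have hle : ∀ t, |r t| ≤ ‖γ t - z‖ / ‖ρ‖ := fun t => by
    rw [← norm_div]; exact Complex.abs_re_le_norm _
  suffices H : ∃ s ∈ Icc a b, ∀ t ∈ Icc a b, c * |t - s| ≤ |r t| by
    obtain ⟨s, hs, H⟩ := H
    exact ⟨s, hs, fun t ht => (H t ht).trans (hle t)⟩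
  have ha : a ∈ Icc a b := ⟨le_rfl, hab⟩
  have hb : b ∈ Icc a b := ⟨hab, le_rfl⟩
  rcases le_total 0 (r a) with h0 | h0
  · refine ⟨a, ha, fun t ht => ?_⟩
    rw [abs_of_nonneg (sub_nonneg.2 ht.1)]
    linarith [hmono a ha t ht ht.1, le_abs_self (r t)]
  rcases le_total (r b) 0 with h1 | h1
  · refine ⟨b, hb, fun t ht => ?_⟩
    rw [abs_sub_comm, abs_of_nonneg (sub_nonneg.2 ht.2)]
    linarith [hmono t ht b hb ht.2, neg_abs_le (r t)]
  obtain ⟨s, hs, hs0⟩ := intermediate_value_Icc hab hcont.continuousOn ⟨h0, h1⟩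
  refine ⟨s, hs, fun t ht => ?_⟩
  rcases le_total s t with hst | hst
  · rw [abs_of_nonneg (sub_nonneg.2 hst)]
    linarith [hmono s hs t ht hst, le_abs_self (r t)]
  · rw [abs_sub_comm, abs_of_nonneg (sub_nonneg.2 hst)]
    linarith [hmono t ht s hs hst, neg_abs_le (r t)]

/-- After division by `ρ`, the curve is a graph that meets the vertical line through `z` at most
once. It misses one of the two vertical rays from `z`, and `σ = ±I` turns that ray into the slit. -/
theorem exists_rotation_mem_slitPlane (hγ : ContDiff ℝ 1 γ) {a b c : ℝ} {ρ : ℂ}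
    (hc : 0 < c) (hρ : ρ ≠ 0) (h : ∀ t ∈ Icc a b, c ≤ (deriv γ t / ρ).re) {z : ℂ}
    (hz : ∀ t ∈ Icc a b, γ t ≠ z) :
    ∃ σ : ℂ, ‖σ‖ = 1 ∧ ∀ t ∈ Icc a b, σ / ρ * (γ t - z) ∈ Complex.slitPlane := by
  have key : ∀ s ∈ Icc a b, ∀ t ∈ Icc a b, ((γ s - z) / ρ).re = 0 → ((γ t - z) / ρ).re = 0 →
      s = t := by
    intro s hs t ht h1 h2
    rcases le_total s t with hst | hst
    · have := mul_sub_le_re_sub hγ h (z := z) hs ht hst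
      nlinarith
    · have := mul_sub_le_re_sub hγ h (z := z) ht hs hst
      nlinarith
  by_cases hex : ∃ s ∈ Icc a b, ((γ s - z) / ρ).re = 0 ∧ ((γ s - z) / ρ).im < 0
  · obtain ⟨s, hs, h0, him⟩ := hex
    refine ⟨Complex.I, by simp, fun t ht => ?_⟩
    rw [div_mul_eq_mul_div, mul_div_assoc, Complex.mem_slitPlane_iff]
    simp only [Complex.I_mul_re, Complex.I_mul_im]
    by_cases h1 : ((γ t - z) / ρ).re = 0
    · rw [← key s hs t ht h0 h1]
      exact Or.inl (by linarith)
    · exact Or.inr h1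
  · push Not at hex
    refine ⟨-Complex.I, by simp, fun t ht => ?_⟩
    rw [div_mul_eq_mul_div, mul_div_assoc, Complex.mem_slitPlane_iff]
    simp only [neg_mul, Complex.neg_re, Complex.neg_im, Complex.I_mul_re, Complex.I_mul_im, neg_neg,
      neg_ne_zero]
    by_cases h1 : ((γ t - z) / ρ).re = 0
    · refine Or.inl ((hex t ht h1).lt_of_ne fun h2 => ?_)
      have : (γ t - z) / ρ = 0 := Complex.ext h1 h2.symm
      exact hz t ht (sub_eq_zero.1 ((div_eq_zero_iff.1 this).resolve_right hρ))
    · exact Or.inr h1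

/-! ### Cauchy integrals of Hölder continuous functions along one curve -/

theorem continuousOn_of_holder {E : Type*} [NormedAddCommGroup E] {v : ℝ → E} {H : ℝ}
    (hv : ∀ s ∈ Icc (0 : ℝ) 1, ∀ t ∈ Icc (0 : ℝ) 1, ‖v t - v s‖ ≤ H * |t - s| ^ (1 / 2 : ℝ)) :
    ContinuousOn v (Icc 0 1) := by
  intro s hs
  have h0 : Tendsto (fun t : ℝ => H * |t - s| ^ (1 / 2 : ℝ)) (𝓝[Icc 0 1] s) (𝓝 0) := by
    have : ContinuousAt (fun t : ℝ => H * |t - s| ^ (1 / 2 : ℝ)) s :=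
      ((continuous_abs.comp (continuous_sub_right s)).continuousAt.rpow_const
        (Or.inr (by norm_num))).const_mul H
    simpa [ContinuousAt] using this.tendsto.mono_left nhdsWithin_le_nhds
  have : Tendsto (fun t => v t - v s) (𝓝[Icc 0 1] s) (𝓝 0) :=
    squeeze_zero_norm' (eventually_mem_nhdsWithin.mono fun t ht => hv s hs t ht) h0
  exact tendsto_sub_nhds_zero_iff.1 this

variable {E : Type*} [NormedAddCommGroup E] [NormedSpace ℂ E]

theorem continuousOn_kernel (hγ : ContDiff ℝ 1 γ) {S : Set ℝ} {z : ℂ} (hz : ∀ t ∈ S, γ t ≠ z) :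
    ContinuousOn (fun t => deriv γ t / (γ t - z)) S :=
  (hγ.continuous_deriv le_rfl).continuousOn.div (hγ.continuous.continuousOn.sub continuousOn_const)
    fun t ht => sub_ne_zero.2 (hz t ht)

theorem norm_kernel_smul_le {v : ℝ → E} {H c M s t : ℝ} {z : ℂ} (hc : 0 < c) (hM : ‖deriv γ t‖ ≤ M)
    (hv : ‖v t - v s‖ ≤ H * |t - s| ^ (1 / 2 : ℝ)) (h : c * |t - s| ≤ ‖γ t - z‖) (hts : t ≠ s) :
    ‖(deriv γ t / (γ t - z)) • (v t - v s)‖ ≤ M * H / c * |t - s| ^ (-(1 / 2) : ℝ) := by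
  have hp : 0 < |t - s| := abs_pos.2 (sub_ne_zero.2 hts)
  have hz : 0 < ‖γ t - z‖ := (mul_pos hc hp).trans_le h
  have hM0 : 0 ≤ M := (norm_nonneg _).trans hM
  rw [norm_smul, norm_div]
  calc ‖deriv γ t‖ / ‖γ t - z‖ * ‖v t - v s‖
      ≤ M / (c * |t - s|) * (H * |t - s| ^ (1 / 2 : ℝ)) := by gcongr
    _ = M * H / c * (|t - s| ^ (1 / 2 : ℝ) / |t - s|) := by field_simp
    _ = M * H / c * |t - s| ^ (-(1 / 2) : ℝ) := by
        rw [← Real.rpow_sub_one hp.ne']; norm_num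

/-- A Cauchy integral along a graph is bounded up to weak singularities at the ends. -/
theorem exists_norm_cauchyIntegral_le [CompleteSpace E] (hγ : ContDiff ℝ 1 γ) {a b c : ℝ} {ρ : ℂ}
    (ha : 0 ≤ a) (hab : a ≤ b) (hb : b ≤ 1) (hc : 0 < c) (hρ : ρ ≠ 0)
    (h : ∀ t ∈ Icc a b, c ≤ (deriv γ t / ρ).re) {v : ℝ → E} {H : ℝ} (hH : 0 ≤ H)
    (hv : ∀ s ∈ Icc (0 : ℝ) 1, ∀ t ∈ Icc (0 : ℝ) 1, ‖v t - v s‖ ≤ H * |t - s| ^ (1 / 2 : ℝ)) :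
    ∃ C, 0 ≤ C ∧ ∀ z, (∀ t ∈ Icc a b, γ t ≠ z) →
      ‖∫ t in a..b, (deriv γ t / (γ t - z)) • v t‖ ≤
        C * (1 + ‖z‖ + ‖γ a - z‖ ^ (-(1 / 4) : ℝ) + ‖γ b - z‖ ^ (-(1 / 4) : ℝ)) := by
  have hsub : Icc a b ⊆ Icc 0 1 := Icc_subset_Icc ha hb
  have hvc := (continuousOn_of_holder hv).mono hsub
  obtain ⟨M, hM⟩ := (isCompact_Icc (a := a) (b := b)).exists_bound_of_continuousOn
    (hγ.continuous_deriv le_rfl).continuousOn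
  obtain ⟨V, hV⟩ := (isCompact_Icc (a := a) (b := b)).exists_bound_of_continuousOn hvc
  have haa : a ∈ Icc a b := ⟨le_rfl, hab⟩
  have hbb : b ∈ Icc a b := ⟨hab, le_rfl⟩
  have hM0 : 0 ≤ M := (norm_nonneg _).trans (hM a haa)
  have hV0 : 0 ≤ V := (norm_nonneg _).trans (hV a haa)
  obtain ⟨κ, hκ, hκb⟩ := exists_integral_abs_sub_rpow_le (show (-1 : ℝ) < -(1 / 2) by norm_num)
  have hρn : 0 < ‖ρ‖ := norm_pos_iff.2 hρ
  set c' := c * ‖ρ‖ with hc'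
  have hc'0 : 0 < c' := mul_pos hc hρn
  set A := M * H / c' * κ with hA
  set q := ‖ρ‖⁻¹ with hq
  set B := 4 * q ^ (-(1 / 4) : ℝ) with hB
  set D := q * (‖γ a‖ + ‖γ b‖) + 2 * Real.pi + 2 * q with hD
  refine ⟨A + V * (D + B), by positivity, fun z hz => ?_⟩
  obtain ⟨s, hs, hsb⟩ := exists_mul_abs_sub_le hγ hab h z
  obtain ⟨σ, hσ, hσs⟩ := exists_rotation_mem_slitPlane hγ hc hρ h hz
  have hk := continuousOn_kernel hγ (S := Icc a b) hz
  have i1 : IntervalIntegrable (fun t => (deriv γ t / (γ t - z)) • (v t - v s)) volume a b :=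
    ContinuousOn.intervalIntegrable (by
      rw [uIcc_of_le hab]; exact hk.smul (hvc.sub continuousOn_const))
  have i2 : IntervalIntegrable (fun t => (deriv γ t / (γ t - z)) • v s) volume a b :=
    ContinuousOn.intervalIntegrable (by rw [uIcc_of_le hab]; exact hk.smul continuousOn_const)
  have e : ∫ t in a..b, (deriv γ t / (γ t - z)) • v t =
      (∫ t in a..b, (deriv γ t / (γ t - z)) • (v t - v s)) +
        (∫ t in a..b, deriv γ t / (γ t - z)) • v s := by
    rw [← intervalIntegral.integral_smul_const, ← intervalIntegral.integral_add i1 i2]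
    simp only [← smul_add, sub_add_cancel]
  have b1 : ‖∫ t in a..b, (deriv γ t / (γ t - z)) • (v t - v s)‖ ≤ A := by
    refine (intervalIntegral.norm_integral_le_of_norm_le
      (g := fun t => M * H / c' * |t - s| ^ (-(1 / 2) : ℝ)) hab ?_ ?_).trans ?_
    · have hne : ∀ᵐ t : ℝ, t ≠ s := by simp [ae_iff, measure_singleton]
      filter_upwards [hne] with t hts ht
      have ht' := Ioc_subset_Icc_self ht
      refine norm_kernel_smul_le hc'0 (hM t ht') (hv s (hsub hs) t (hsub ht')) ?_ hts
      have := hsb t ht'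
      rw [le_div_iff₀ hρn] at this
      rw [hc']; linarith
    · exact (intervalIntegrable_abs_sub_rpow (by norm_num) s a b).const_mul _
    · rw [intervalIntegral.integral_const_mul, hA]
      gcongr
      exact hκb a b s ha hab hb (hsub hs)
  have hlog : ∀ t ∈ Icc a b, ‖Complex.log (σ / ρ * (γ t - z))‖ ≤
      q * (‖γ t‖ + ‖z‖) + B * ‖γ t - z‖ ^ (-(1 / 4) : ℝ) + Real.pi := fun t ht => by
    refine (norm_clog_le (Complex.slitPlane_ne_zero (hσs t ht))).trans ?_
    rw [norm_mul, norm_div, hσ, one_div, Real.mul_rpow (by positivity) (norm_nonneg _), ← hq]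
    have : q * ‖γ t - z‖ ≤ q * (‖γ t‖ + ‖z‖) := by gcongr; exact norm_sub_le _ _
    rw [hB]; linarith
  have b2 : ‖∫ t in a..b, deriv γ t / (γ t - z)‖ ≤ D * (1 + ‖z‖) +
      B * (‖γ a - z‖ ^ (-(1 / 4) : ℝ) + ‖γ b - z‖ ^ (-(1 / 4) : ℝ)) := by
    rw [integral_kernel_eq_clog_sub hγ hab hσs]
    refine (norm_sub_le _ _).trans ((add_le_add (hlog b hbb) (hlog a haa)).trans ?_)
    have h1 : 0 ≤ q * (‖γ a‖ + ‖γ b‖) * ‖z‖ := by positivity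
    have h2 : 0 ≤ Real.pi * ‖z‖ := by positivity
    have h3 : 0 ≤ q := by positivity
    rw [hD]; nlinarith
  rw [e]
  refine (norm_add_le _ _).trans ?_
  rw [norm_smul]
  set X := ‖γ a - z‖ ^ (-(1 / 4) : ℝ) + ‖γ b - z‖ ^ (-(1 / 4) : ℝ) with hX
  have hX0 : 0 ≤ X := by positivity
  have hB0 : 0 ≤ B := by positivity
  have hD0 : 0 ≤ D := by positivity
  have hA0 : 0 ≤ A := by positivity
  have b3 : ‖∫ t in a..b, deriv γ t / (γ t - z)‖ * ‖v s‖ ≤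
      (D * (1 + ‖z‖) + B * X) * V :=
    mul_le_mul b2 (hV s hs) (norm_nonneg _) (by positivity)
  have hz0 := norm_nonneg z
  have e3 : (A + V * (D + B)) * (1 + ‖z‖ + ‖γ a - z‖ ^ (-(1 / 4) : ℝ) +
      ‖γ b - z‖ ^ (-(1 / 4) : ℝ)) = A + (D * (1 + ‖z‖) + B * X) * V +
        (A * ‖z‖ + A * X + V * (D * X) + V * (B * (1 + ‖z‖))) := by rw [hX]; ring
  rw [e3]
  have : 0 ≤ A * ‖z‖ + A * X + V * (D * X) + V * (B * (1 + ‖z‖)) := by positivity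
  linarith


/-! ### Cauchy integrals off a curve, and nontangential approach to it -/

variable {γ : ℝ → ℂ} {E : Type*} [NormedAddCommGroup E] [NormedSpace ℂ E]

theorem exists_dist_pos (hγ : Continuous γ) {K : Set ℝ} (hK : IsCompact K) {w : ℂ}
    (h : ∀ t ∈ K, γ t ≠ w) : ∃ d > 0, ∀ t ∈ K, d ≤ ‖γ t - w‖ := by
  rcases K.eq_empty_or_nonempty with rfl | hne
  · exact ⟨1, one_pos, by simp⟩
  obtain ⟨s, hs, hmin⟩ := hK.exists_isMinOn hne
    ((hγ.sub continuous_const).norm.continuousOn (s := K) (f := fun t => ‖γ t - w‖))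
  exact ⟨_, norm_pos_iff.2 (sub_ne_zero.2 (h s hs)), fun t ht => hmin ht⟩

theorem eventually_forall_ne (hγ : Continuous γ) {K : Set ℝ} (hK : IsCompact K) {w : ℂ}
    (h : ∀ t ∈ K, γ t ≠ w) : ∀ᶠ z in 𝓝 w, ∀ t ∈ K, γ t ≠ z := by
  obtain ⟨d, hd, hdist⟩ := exists_dist_pos hγ hK h
  filter_upwards [Metric.ball_mem_nhds w hd] with z hz t ht hzt
  have := hdist t ht
  rw [hzt, ← dist_eq_norm] at this
  exact absurd (Metric.mem_ball.1 hz) (not_lt.2 this)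

theorem norm_kernel_le {t M d : ℝ} {z : ℂ} (hM : ‖deriv γ t‖ ≤ M) (hd : 0 < d)
    (h : d ≤ ‖γ t - z‖) : ‖deriv γ t / (γ t - z)‖ ≤ M / d := by
  rw [norm_div]
  have := (norm_nonneg _).trans hM
  gcongr

theorem differentiableAt_cauchyIntegral [CompleteSpace E] (hγ : ContDiff ℝ 1 γ) {S : Set ℝ}
    (hS : MeasurableSet S) (hS1 : S ⊆ Icc 0 1) {u : ℝ → E} (hu : IntegrableOn u S) {d : ℝ} {w : ℂ}
    (hd : 0 < d) (h : ∀ t ∈ S, d ≤ ‖γ t - w‖) :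
    DifferentiableAt ℂ (fun z => ∫ t in S, (deriv γ t / (γ t - z)) • u t) w := by
  obtain ⟨M, hM⟩ := (isCompact_Icc (a := (0 : ℝ)) (b := 1)).exists_bound_of_continuousOn
    (hγ.continuous_deriv le_rfl).continuousOn
  have hmd : Measurable (deriv γ) := (hγ.continuous_deriv le_rfl).measurable
  have hk : ∀ z, AEStronglyMeasurable (fun t => deriv γ t / (γ t - z)) (volume.restrict S) :=
    fun z => (hmd.div (hγ.continuous.measurable.sub_const z)).aestronglyMeasurable
  have hdist : ∀ z ∈ Metric.ball w (d / 2), ∀ t ∈ S, d / 2 ≤ ‖γ t - z‖ := fun z hz t ht => by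
    have h1 := h t ht
    have h2 := norm_add_le (γ t - z) (z - w)
    rw [sub_add_sub_cancel] at h2
    rw [Metric.mem_ball, dist_eq_norm] at hz
    linarith
  refine (hasDerivAt_integral_of_dominated_loc_of_deriv_le (μ := volume.restrict S)
    (F := fun z t => (deriv γ t / (γ t - z)) • u t)
    (F' := fun z t => (deriv γ t / (γ t - z) ^ 2) • u t)
    (bound := fun t => M / (d / 2) ^ 2 * ‖u t‖) (Metric.ball_mem_nhds w (half_pos hd))
    (Eventually.of_forall fun z => (hk z).smul hu.1) ?_ ?_ ?_ (hu.norm.const_mul _)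
    ?_).2.differentiableAt
  · refine hu.bdd_smul (M / d) (hk w) ?_
    filter_upwards [ae_restrict_mem hS] with t ht using norm_kernel_le (hM t (hS1 ht)) hd (h t ht)
  · exact (hmd.div ((hγ.continuous.measurable.sub_const w).pow_const 2)).aestronglyMeasurable.smul
      hu.1
  · filter_upwards [ae_restrict_mem hS] with t ht z hz
    rw [norm_smul, norm_div, norm_pow]
    have h1 := hdist z hz t ht
    have h2 := hM t (hS1 ht)
    have h3 := (norm_nonneg _).trans h2
    gcongr
  · filter_upwards [ae_restrict_mem hS] with t ht z hz
    have hne : γ t - z ≠ 0 := norm_pos_iff.1 ((half_pos hd).trans_le (hdist z hz t ht))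
    have h1 : HasDerivAt (fun z => deriv γ t / (γ t - z)) (deriv γ t / (γ t - z) ^ 2) z := by
      have := (hasDerivAt_const z (deriv γ t)).div ((hasDerivAt_id z).const_sub (γ t)) hne
      refine this.congr_deriv ?_
      simp
    exact h1.smul_const (u t)

/-- The cone of aperture `m` at `γ t`, on the left or on the right. -/
def cone (γ : ℝ → ℂ) (left : Bool) (t : ℝ) (m : ℕ) : Set ℂ :=
  {z | 0 < (if left then 1 else -1) * ((z - γ t) / deriv γ t).im ∧
    |((z - γ t) / deriv γ t).re| ≤ m * |((z - γ t) / deriv γ t).im|}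

/-- In coordinates where the tangent is the real axis, `s` is the tangent point, `ζ` the point of
the cone and `e` the deviation of the curve from its tangent. A real `s` has distance at least `|s|
/ (1 + m)` from the cone, and `e` uses up at most half of it. -/
theorem norm_sub_ge_of_mem_cone {ζ e : ℂ} {s : ℝ} {m : ℝ} (hm : 0 ≤ m) (h : |ζ.re| ≤ m * |ζ.im|)
    (he : ‖e‖ ≤ 1 / (2 * (1 + m)) * |s|) : 1 / (2 * (1 + m)) * |s| ≤ ‖s - ζ + e‖ := by
  have h1 : |s| ≤ (1 + m) * ‖(s : ℂ) - ζ‖ := by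
    have hr := Complex.abs_re_le_norm ((s : ℂ) - ζ)
    have hi := Complex.abs_im_le_norm ((s : ℂ) - ζ)
    simp only [Complex.sub_re, Complex.ofReal_re, Complex.sub_im, Complex.ofReal_im, zero_sub,
      abs_neg] at hr hi
    have h2 : |s| ≤ |s - ζ.re| + |ζ.re| := by simpa using abs_add_le (s - ζ.re) ζ.re
    nlinarith
  have h3 : ‖(s : ℂ) - ζ‖ ≤ ‖(s : ℂ) - ζ + e‖ + ‖e‖ := by
    simpa using norm_sub_le ((s : ℂ) - ζ + e) e
  have h4 : |s| / (1 + m) ≤ ‖(s : ℂ) - ζ‖ := by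
    rw [div_le_iff₀ (by positivity)]; linarith
  have h5 : |s| / (1 + m) = 2 * (1 / (2 * (1 + m)) * |s|) := by field_simp
  linarith

/-- To land on the slit, the curve would have to pass through the normal line of `ζ` on the far side
of `ζ`. On that line `|s| ≤ 2 m |Im ζ|`, which makes the deviation `e` smaller than `|Im ζ|`. -/
theorem rotation_mem_slitPlane_of_mem_cone {ζ e : ℂ} {s ε m : ℝ} (hm : 0 ≤ m)
    (hε : ε = 1 ∨ ε = -1) (hpos : 0 < ε * ζ.im) (h : |ζ.re| ≤ m * |ζ.im|)
    (he : ‖e‖ ≤ 1 / (2 * (1 + m)) * |s|) :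
    ε * Complex.I * (s - ζ + e) ∈ Complex.slitPlane := by
  rw [Complex.mem_slitPlane_iff]
  have hre : (ε * Complex.I * (s - ζ + e)).re = ε * ζ.im - ε * e.im := by
    simp; ring
  have him : (ε * Complex.I * (s - ζ + e)).im = ε * (s - ζ.re + e.re) := by
    simp
  rw [hre, him]
  by_cases h0 : s - ζ.re + e.re = 0
  · left
    have habs : |ζ.im| = ε * ζ.im := by
      rcases hε with rfl | rfl
      · rw [abs_of_pos (by linarith)]; ring
      · rw [abs_of_neg (by linarith)]; ring
    have h1 := (Complex.abs_re_le_norm e).trans he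
    have h2 := (Complex.abs_im_le_norm e).trans he
    have h3 : ε * e.im ≤ |e.im| := by
      rcases hε with rfl | rfl
      · simpa using le_abs_self e.im
      · simpa using neg_le_abs e.im
    have h4 : |s| ≤ |ζ.re| + |e.re| := by
      have : s = ζ.re - e.re := by linarith
      rw [this]; exact abs_sub _ _
    have h5 : 1 / (2 * (1 + m)) * |s| ≤ 1 / 2 * |s| := by
      gcongr; linarith
    have h6 : |s| ≤ 2 * (m * |ζ.im|) := by linarith
    have h7 : 1 / (2 * (1 + m)) * |s| ≤ 1 / (2 * (1 + m)) * (2 * (m * |ζ.im|)) := by gcongr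
    have h8 : 1 / (2 * (1 + m)) * (2 * (m * |ζ.im|)) = |ζ.im| - |ζ.im| / (1 + m) := by
      field_simp; ring
    have h9 : 0 < |ζ.im| / (1 + m) := by rw [habs]; positivity
    linarith
  · right
    exact mul_ne_zero (by rcases hε with rfl | rfl <;> norm_num) h0

theorem exists_tendsto_window [CompleteSpace E] (hγ : ContDiff ℝ 1 γ) {t₀ : ℝ}
    (ht₀ : t₀ ∈ Ioo (0 : ℝ) 1) (hp : deriv γ t₀ ≠ 0) {v : ℝ → E} {H : ℝ}
    (hv : ∀ s ∈ Icc (0 : ℝ) 1, ∀ t ∈ Icc (0 : ℝ) 1, ‖v t - v s‖ ≤ H * |t - s| ^ (1 / 2 : ℝ))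
    (left : Bool) (m : ℕ) :
    ∃ h > 0, 0 ≤ t₀ - h ∧ t₀ + h ≤ 1 ∧
      (∀ z ∈ cone γ left t₀ m, ∀ t ∈ Icc (t₀ - h) (t₀ + h), γ t ≠ z) ∧
      ∃ L, Tendsto (fun z => ∫ t in (t₀ - h)..(t₀ + h), (deriv γ t / (γ t - z)) • v t)
        (𝓝[cone γ left t₀ m] (γ t₀)) (𝓝 L) := by
  set p := deriv γ t₀ with hpdef
  set ε : ℝ := if left then 1 else -1 with hεdef
  have hε : ε = 1 ∨ ε = -1 := by cases left <;> simp [hεdef]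
  have hε0 : ε ≠ 0 := by rcases hε with h | h <;> rw [h] <;> norm_num
  have hpn : 0 < ‖p‖ := norm_pos_iff.2 hp
  set η : ℝ := 1 / (2 * (1 + m)) with hη
  have hη0 : 0 < η := by positivity
  have hη1 : η ≤ 1 / 2 := by
    rw [hη]; gcongr; linarith [(Nat.cast_nonneg m : (0 : ℝ) ≤ m)]
  -- Differentiability at `t₀` makes the relative deviation from the tangent at most the `η` that
  -- the cone of aperture `m` tolerates; the window size thus depends on `m`.
  have hlo : ∀ᶠ t in 𝓝 t₀, ‖γ t - γ t₀ - (t - t₀) • p‖ ≤ η * ‖p‖ * ‖t - t₀‖ :=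
    ((hγ.differentiable one_ne_zero t₀).hasDerivAt.isLittleO).def (by positivity)
  obtain ⟨r, hr, hball⟩ := Metric.eventually_nhds_iff.1 (hlo.and (Ioo_mem_nhds ht₀.1 ht₀.2))
  set h := r / 2 with hh
  have hh0 : 0 < h := half_pos hr
  have hmem : ∀ t ∈ Icc (t₀ - h) (t₀ + h), dist t t₀ < r := fun t ht => by
    rw [Real.dist_eq, abs_lt]; constructor <;> linarith [ht.1, ht.2]
  have hsub : Icc (t₀ - h) (t₀ + h) ⊆ Icc 0 1 := fun t ht =>
    Ioo_subset_Icc_self (hball (hmem t ht)).2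
  have hab : t₀ - h ≤ t₀ + h := by linarith
  have haa : t₀ - h ∈ Icc (t₀ - h) (t₀ + h) := ⟨le_rfl, hab⟩
  have hbb : t₀ + h ∈ Icc (t₀ - h) (t₀ + h) := ⟨hab, le_rfl⟩
  have ht0 : t₀ ∈ Icc (t₀ - h) (t₀ + h) := ⟨by linarith, by linarith⟩
  -- the curve is close to its tangent
  let e : ℝ → ℂ := fun t => (γ t - γ t₀) / p - ((t - t₀ : ℝ) : ℂ)
  have he : ∀ t ∈ Icc (t₀ - h) (t₀ + h), ‖e t‖ ≤ η * |t - t₀| := fun t ht => by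
    have h1 := (hball (hmem t ht)).1
    have h2 : e t = (γ t - γ t₀ - (t - t₀) • p) / p := by
      simp only [e, Complex.real_smul]; field_simp
    rw [h2, norm_div, div_le_iff₀ hpn]
    refine h1.trans (le_of_eq ?_)
    rw [Real.norm_eq_abs]; ring
  have hdec : ∀ t z, (γ t - z) / p = ((t - t₀ : ℝ) : ℂ) - (z - γ t₀) / p + e t := fun t z => by
    simp only [e]; ring
  have hslit : ∀ z ∈ cone γ left t₀ m, ∀ t ∈ Icc (t₀ - h) (t₀ + h),
      ε * Complex.I / p * (γ t - z) ∈ Complex.slitPlane := fun z hz t ht => by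
    rw [div_mul_eq_mul_div, mul_div_assoc, hdec]
    exact rotation_mem_slitPlane_of_mem_cone (Nat.cast_nonneg m) hε hz.1 hz.2 (he t ht)
  have hne : ∀ z ∈ cone γ left t₀ m, ∀ t ∈ Icc (t₀ - h) (t₀ + h), γ t ≠ z := fun z hz t ht htz =>
    Complex.slitPlane_ne_zero (hslit z hz t ht) (by rw [htz]; simp)
  have hlow : ∀ z ∈ cone γ left t₀ m, ∀ t ∈ Icc (t₀ - h) (t₀ + h),
      η * ‖p‖ * |t - t₀| ≤ ‖γ t - z‖ := fun z hz t ht => by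
    have := norm_sub_ge_of_mem_cone (Nat.cast_nonneg m) hz.2 (he t ht)
    rw [← hdec, norm_div, le_div_iff₀ hpn] at this
    linarith
  have hre : ∀ t ∈ Icc (t₀ - h) (t₀ + h), t ≠ t₀ → ((γ t - γ t₀) / p).re ≠ 0 :=
    fun t ht htt h0 => by
      have h1 := (Complex.abs_re_le_norm (e t)).trans (he t ht)
      have h2 : (e t).re = -(t - t₀) := by
        simp only [e, Complex.sub_re, h0, Complex.ofReal_re, zero_sub]
      rw [h2, abs_neg] at h1
      have h3 : 0 < |t - t₀| := abs_pos.2 (sub_ne_zero.2 htt)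
      nlinarith
  refine ⟨h, hh0, (hsub haa).1, (hsub hbb).2, hne, ?_⟩
  have hvc := (continuousOn_of_holder hv).mono hsub
  obtain ⟨M, hM⟩ := (isCompact_Icc (a := t₀ - h) (b := t₀ + h)).exists_bound_of_continuousOn
    (hγ.continuous_deriv le_rfl).continuousOn
  have hη' : 0 < η * ‖p‖ := by positivity
  have hnull : ∀ᵐ t : ℝ, t ≠ t₀ := by simp [ae_iff, measure_singleton]
  -- Within the cone, `‖γ t - z‖` is at least a multiple of `|t - t₀|`, so dominated convergence
  -- applies with majorant `|t - t₀|^(-1/2)`.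
  have lim1 : Tendsto (fun z => ∫ t in (t₀ - h)..(t₀ + h), (deriv γ t / (γ t - z)) • (v t - v t₀))
      (𝓝[cone γ left t₀ m] (γ t₀)) (𝓝 (∫ t in (t₀ - h)..(t₀ + h),
        (deriv γ t / (γ t - γ t₀)) • (v t - v t₀))) := by
    refine intervalIntegral.tendsto_integral_filter_of_dominated_convergence
      (fun t => M * H / (η * ‖p‖) * |t - t₀| ^ (-(1 / 2) : ℝ)) ?_ ?_
      ((intervalIntegrable_abs_sub_rpow (by norm_num) t₀ _ _).const_mul _) ?_
    · filter_upwards [self_mem_nhdsWithin] with z hz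
      rw [uIoc_of_le hab]
      exact (((continuousOn_kernel hγ (hne z hz)).smul (hvc.sub continuousOn_const)).mono
        Ioc_subset_Icc_self).aestronglyMeasurable measurableSet_Ioc
    · filter_upwards [self_mem_nhdsWithin] with z hz
      filter_upwards [hnull] with t htt ht
      rw [uIoc_of_le hab] at ht
      have ht' := Ioc_subset_Icc_self ht
      exact norm_kernel_smul_le hη' (hM t ht') (hv t₀ (hsub ht0) t (hsub ht')) (hlow z hz t ht') htt
    · filter_upwards [hnull] with t htt ht
      rw [uIoc_of_le hab] at ht
      have hγne : γ t - γ t₀ ≠ 0 := fun h0 => hre t (Ioc_subset_Icc_self ht) htt (by simp [h0])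
      have : ContinuousAt (fun z => (deriv γ t / (γ t - z)) • (v t - v t₀)) (γ t₀) :=
        (continuousAt_const.div (continuousAt_const.sub continuousAt_id) hγne).smul
          continuousAt_const
      exact this.tendsto.mono_left nhdsWithin_le_nhds
  have hlog : ∀ t ∈ Icc (t₀ - h) (t₀ + h), t ≠ t₀ →
      Tendsto (fun z => Complex.log (ε * Complex.I / p * (γ t - z)))
        (𝓝[cone γ left t₀ m] (γ t₀)) (𝓝 (Complex.log (ε * Complex.I / p * (γ t - γ t₀)))) :=
    fun t ht htt => by
      have hs : ε * Complex.I / p * (γ t - γ t₀) ∈ Complex.slitPlane := by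
        rw [div_mul_eq_mul_div, mul_div_assoc, Complex.mem_slitPlane_iff]
        right
        have : (ε * Complex.I * ((γ t - γ t₀) / p)).im = ε * ((γ t - γ t₀) / p).re := by simp
        rw [this]
        exact mul_ne_zero hε0 (hre t ht htt)
      have : ContinuousAt (fun z => Complex.log (ε * Complex.I / p * (γ t - z))) (γ t₀) :=
        (continuousAt_const.mul (continuousAt_const.sub continuousAt_id)).clog hs
      exact this.tendsto.mono_left nhdsWithin_le_nhds
  -- The subtracted constant contributes logarithms at the two ends of the window, both away from
  -- the singularity.
  have lim2 := (hlog _ hbb (by linarith)).sub (hlog _ haa (by linarith))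
  refine ⟨_, (lim1.add (lim2.smul_const (v t₀))).congr' ?_⟩
  filter_upwards [self_mem_nhdsWithin] with z hz
  have hk := continuousOn_kernel hγ (hne z hz)
  have i1 : IntervalIntegrable (fun t => (deriv γ t / (γ t - z)) • (v t - v t₀)) volume
      (t₀ - h) (t₀ + h) := ContinuousOn.intervalIntegrable (by
    rw [uIcc_of_le hab]; exact hk.smul (hvc.sub continuousOn_const))
  have i2 : IntervalIntegrable (fun t => (deriv γ t / (γ t - z)) • v t₀) volume
      (t₀ - h) (t₀ + h) := ContinuousOn.intervalIntegrable (by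
    rw [uIcc_of_le hab]; exact hk.smul continuousOn_const)
  rw [← integral_kernel_eq_clog_sub hγ hab (hslit z hz), ← intervalIntegral.integral_smul_const,
    ← intervalIntegral.integral_add i1 i2]
  simp only [← smul_add, sub_add_cancel]


/-! ### A single curve: limits in cones and square integrable bounds -/

section Curve

variable {γ : ℝ → ℂ} {E : Type*} [NormedAddCommGroup E] [NormedSpace ℂ E]

/-- Nontangential limits of the Cauchy integral of a Hölder continuous function along a simple
arc. -/
theorem exists_tendsto_cone [CompleteSpace E] (hγ : ContDiff ℝ 1 γ) {t₀ : ℝ}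
    (ht₀ : t₀ ∈ Ioo (0 : ℝ) 1) (hp : deriv γ t₀ ≠ 0)
    (hinj : ∀ t ∈ Icc (0 : ℝ) 1, γ t = γ t₀ → t = t₀) {v : ℝ → E} {H : ℝ}
    (hv : ∀ s ∈ Icc (0 : ℝ) 1, ∀ t ∈ Icc (0 : ℝ) 1, ‖v t - v s‖ ≤ H * |t - s| ^ (1 / 2 : ℝ))
    (left : Bool) (m : ℕ) :
    (∀ᶠ z in 𝓝[cone γ left t₀ m] (γ t₀), ∀ t ∈ Icc (0 : ℝ) 1, γ t ≠ z) ∧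
      ∃ L, Tendsto (fun z => ∫ t in Ioo (0 : ℝ) 1, (deriv γ t / (γ t - z)) • v t)
        (𝓝[cone γ left t₀ m] (γ t₀)) (𝓝 L) := by
  obtain ⟨h, hh, h0, h1, hne, L, hL⟩ := exists_tendsto_window hγ ht₀ hp hv left m
  have hvi : IntegrableOn v (Icc 0 1) := (continuousOn_of_holder hv).integrableOn_Icc
  have hne1 : ∀ t ∈ Icc 0 (t₀ - h), γ t ≠ γ t₀ := fun t ht he => by
    have := hinj t ⟨ht.1, by linarith [ht.2, ht₀.2]⟩ he
    linarith [ht.2]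
  have hne2 : ∀ t ∈ Icc (t₀ + h) 1, γ t ≠ γ t₀ := fun t ht he => by
    have := hinj t ⟨by linarith [ht.1, ht₀.1], ht.2⟩ he
    linarith [ht.1]
  have hev : ∀ᶠ z in 𝓝[cone γ left t₀ m] (γ t₀), ∀ t ∈ Icc (0 : ℝ) 1, γ t ≠ z := by
    filter_upwards [self_mem_nhdsWithin,
      nhdsWithin_le_nhds (eventually_forall_ne hγ.continuous isCompact_Icc hne1),
      nhdsWithin_le_nhds (eventually_forall_ne hγ.continuous isCompact_Icc hne2)]
      with z hz hz1 hz2 t ht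
    rcases le_total t (t₀ - h) with h3 | h3
    · exact hz1 t ⟨ht.1, h3⟩
    rcases le_total t (t₀ + h) with h4 | h4
    · exact hne z hz t ⟨h3, h4⟩
    · exact hz2 t ⟨h4, ht.2⟩
  have hside : ∀ a b, 0 ≤ a → a ≤ b → b ≤ 1 → (∀ t ∈ Icc a b, γ t ≠ γ t₀) →
      Tendsto (fun z => ∫ t in a..b, (deriv γ t / (γ t - z)) • v t)
        (𝓝[cone γ left t₀ m] (γ t₀)) (𝓝 (∫ t in a..b, (deriv γ t / (γ t - γ t₀)) • v t)) :=
    fun a b ha hab hb hab' => by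
      obtain ⟨d, hd, hdist⟩ := exists_dist_pos hγ.continuous isCompact_Icc hab'
      have hsub : Ioc a b ⊆ Icc 0 1 := Ioc_subset_Icc_self.trans (Icc_subset_Icc ha hb)
      have := (differentiableAt_cauchyIntegral hγ measurableSet_Ioc hsub (hvi.mono_set hsub) hd
        fun t ht => hdist t (Ioc_subset_Icc_self ht)).continuousAt
      simp only [intervalIntegral.integral_of_le hab]
      exact this.tendsto.mono_left nhdsWithin_le_nhds
  refine ⟨hev, _, (((hside _ _ le_rfl h0 (by linarith) hne1).add hL).add
    (hside _ _ (by linarith) h1 le_rfl hne2)).congr' ?_⟩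
  filter_upwards [hev] with z hz
  have hi : ∀ a b, a ∈ Icc (0 : ℝ) 1 → b ∈ Icc (0 : ℝ) 1 →
      IntervalIntegrable (fun t => (deriv γ t / (γ t - z)) • v t) volume a b := fun a b ha hb =>
    (((continuousOn_kernel hγ hz).smul (continuousOn_of_holder hv)).mono
      (by rw [← uIcc_of_le (zero_le_one' ℝ)] at ha hb ⊢
          exact uIcc_subset_uIcc ha hb)).intervalIntegrable
  have m0 : (0 : ℝ) ∈ Icc (0 : ℝ) 1 := by simp
  have m1 : (1 : ℝ) ∈ Icc (0 : ℝ) 1 := by simp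
  have ma : t₀ - h ∈ Icc (0 : ℝ) 1 := ⟨h0, by linarith⟩
  have mb : t₀ + h ∈ Icc (0 : ℝ) 1 := ⟨by linarith, h1⟩
  rw [intervalIntegral.integral_add_adjacent_intervals (hi _ _ m0 ma) (hi _ _ ma mb),
    intervalIntegral.integral_add_adjacent_intervals (hi _ _ m0 mb) (hi _ _ mb m1),
    intervalIntegral.integral_of_le zero_le_one, integral_Ioc_eq_integral_Ioo]

/-- A regular curve is a finite union of graphs. -/
theorem exists_graph_partition (hγ : ContDiff ℝ 1 γ) (hr : ∀ t ∈ Icc (0 : ℝ) 1, deriv γ t ≠ 0) :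
    ∃ K : ℕ, 0 < K ∧ ∀ k < K, ∀ t ∈ Icc (k / K : ℝ) ((k + 1 : ℕ) / K),
      1 / 2 ≤ (deriv γ t / deriv γ (k / K)).re := by
  have hc := (hγ.continuous_deriv le_rfl)
  obtain ⟨s, hs, hmin⟩ := (isCompact_Icc (a := (0 : ℝ)) (b := 1)).exists_isMinOn ⟨0, by simp⟩
    hc.norm.continuousOn
  have hpos : 0 < ‖deriv γ s‖ := norm_pos_iff.2 (hr s hs)
  -- A tolerance of half the minimal speed keeps `γ' t / γ' (k / K)` within distance 1/2 of 1.
  obtain ⟨δ, hδ, hu⟩ := Metric.uniformContinuousOn_iff.1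
    (isCompact_Icc.uniformContinuousOn_of_continuous (hc.continuousOn (s := Icc (0 : ℝ) 1)))
    (‖deriv γ s‖ / 2) (half_pos hpos)
  obtain ⟨n, hn⟩ := exists_nat_one_div_lt hδ
  refine ⟨n + 1, Nat.succ_pos n, fun k hk t ht => ?_⟩
  have hK : (0 : ℝ) < (n + 1 : ℕ) := by positivity
  have hk1 : ((k + 1 : ℕ) : ℝ) ≤ (n + 1 : ℕ) := by exact_mod_cast hk
  have ha : (k : ℝ) / (n + 1 : ℕ) ∈ Icc (0 : ℝ) 1 := ⟨by positivity, by
    rw [div_le_one hK]; push_cast at hk1 ⊢; linarith⟩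
  have ht1 : t ∈ Icc (0 : ℝ) 1 := ⟨ha.1.trans ht.1, ht.2.trans ((div_le_one hK).2 hk1)⟩
  have hdist : dist t ((k : ℝ) / (n + 1 : ℕ)) < δ := by
    rw [Real.dist_eq, abs_of_nonneg (sub_nonneg.2 ht.1)]
    refine lt_of_le_of_lt ?_ hn
    have h2 := ht.2
    have : ((k + 1 : ℕ) : ℝ) / (n + 1 : ℕ) = (k : ℝ) / (n + 1 : ℕ) + 1 / (n + 1) := by
      push_cast; ring
    linarith
  have h1 := hu t ht1 _ ha hdist
  set p := deriv γ ((k : ℝ) / (n + 1 : ℕ)) with hp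
  have hp0 : p ≠ 0 := hr _ ha
  have h3 : ‖deriv γ t / p - 1‖ ≤ 1 / 2 := by
    rw [div_sub_one hp0, norm_div, div_le_iff₀ (norm_pos_iff.2 hp0), ← dist_eq_norm]
    have h4 : ‖deriv γ s‖ ≤ ‖p‖ := hmin ha
    linarith
  have h4 := (abs_le.1 ((Complex.abs_re_le_norm _).trans h3)).1
  rw [Complex.sub_re, Complex.one_re] at h4
  linarith

/-- Weak singularities at the points of `P`. -/
noncomputable def weakSing (P : Finset ℂ) (z : ℂ) : ℝ :=
  1 + ‖z‖ + ∑ w ∈ P, ‖w - z‖ ^ (-(1 / 4) : ℝ)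

theorem weakSing_mono {P Q : Finset ℂ} (h : P ⊆ Q) (z : ℂ) : weakSing P z ≤ weakSing Q z :=
  add_le_add_right (Finset.sum_le_sum_of_subset_of_nonneg h fun _ _ _ => by positivity) _

theorem weakSing_nonneg (P : Finset ℂ) (z : ℂ) : 0 ≤ weakSing P z := by
  unfold weakSing; positivity

theorem continuousAt_weakSing {P : Finset ℂ} {z : ℂ} (hz : z ∉ P) :
    ContinuousAt (weakSing P) z := by
  unfold weakSing
  refine (continuousAt_const.add continuous_norm.continuousAt).add
    (tendsto_finsetSum _ fun w hw => ?_)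
  have hne : ‖w - z‖ ≠ 0 := norm_ne_zero_iff.2 (sub_ne_zero.2 fun h => hz (h ▸ hw))
  exact ContinuousAt.rpow_const (f := fun z => ‖w - z‖)
    (continuousAt_const.sub continuousAt_id).norm (Or.inl hne)

/-- The bound on graphs is summed over a partition; the singular points are the images of the
partition points. Each piece has two ends, whence the factor 2. -/
theorem exists_norm_cauchyIntegral_le_weakSing [CompleteSpace E] (hγ : ContDiff ℝ 1 γ)
    (hr : ∀ t ∈ Icc (0 : ℝ) 1, deriv γ t ≠ 0) {v : ℝ → E} {H : ℝ} (hH : 0 ≤ H)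
    (hv : ∀ s ∈ Icc (0 : ℝ) 1, ∀ t ∈ Icc (0 : ℝ) 1, ‖v t - v s‖ ≤ H * |t - s| ^ (1 / 2 : ℝ)) :
    ∃ C, 0 ≤ C ∧ ∃ P : Finset ℂ, ∀ z, (∀ t ∈ Icc (0 : ℝ) 1, γ t ≠ z) →
      ‖∫ t in Ioo (0 : ℝ) 1, (deriv γ t / (γ t - z)) • v t‖ ≤ C * weakSing P z := by
  classical
  obtain ⟨K, hK0, hK⟩ := exists_graph_partition hγ hr
  have hKr : (0 : ℝ) < K := by exact_mod_cast hK0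
  have hmem : ∀ k ≤ K, (k : ℝ) / K ∈ Icc (0 : ℝ) 1 := fun k hk =>
    ⟨by positivity, (div_le_one hKr).2 (by exact_mod_cast hk)⟩
  have hle : ∀ k : ℕ, (k : ℝ) / K ≤ (k + 1 : ℕ) / K := fun k => by gcongr; simp
  have hex : ∀ k, ∃ C, 0 ≤ C ∧ (k < K → ∀ z, (∀ t ∈ Icc (k / K : ℝ) ((k + 1 : ℕ) / K), γ t ≠ z) →
      ‖∫ t in (k / K : ℝ)..((k + 1 : ℕ) / K), (deriv γ t / (γ t - z)) • v t‖ ≤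
        C * (1 + ‖z‖ + ‖γ (k / K) - z‖ ^ (-(1 / 4) : ℝ) +
          ‖γ ((k + 1 : ℕ) / K) - z‖ ^ (-(1 / 4) : ℝ))) := fun k => by
    by_cases hk : k < K
    · obtain ⟨C, hC, h⟩ := exists_norm_cauchyIntegral_le hγ (hmem k hk.le).1 (hle k)
        (hmem (k + 1) hk).2 one_half_pos (hr _ (hmem k hk.le)) (hK k hk) hH hv
      exact ⟨C, hC, fun _ => h⟩
    · exact ⟨0, le_rfl, fun h => absurd h hk⟩
  choose C hC hb using hex
  refine ⟨∑ k ∈ Finset.range K, C k * 2, Finset.sum_nonneg fun k _ => by have := hC k; positivity,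
    (Finset.range (K + 1)).image fun k : ℕ => γ (k / K), fun z hz => ?_⟩
  set P := (Finset.range (K + 1)).image fun k : ℕ => γ (k / K) with hP
  have hi : ∀ k < K, IntervalIntegrable (fun t => (deriv γ t / (γ t - z)) • v t) volume
      (k / K : ℝ) ((k + 1 : ℕ) / K) := fun k hk =>
    (((continuousOn_kernel hγ hz).smul (continuousOn_of_holder hv)).mono
      (by rw [uIcc_of_le (hle k)]
          exact Icc_subset_Icc (hmem k hk.le).1 (hmem (k + 1) hk).2)).intervalIntegrable
  have hsum := intervalIntegral.sum_integral_adjacent_intervals (a := fun k : ℕ => (k / K : ℝ)) hi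
  have e : ∫ t in Ioo (0 : ℝ) 1, (deriv γ t / (γ t - z)) • v t =
      ∑ k ∈ Finset.range K, ∫ t in (k / K : ℝ)..((k + 1 : ℕ) / K),
        (deriv γ t / (γ t - z)) • v t := by
    rw [hsum, Nat.cast_zero, zero_div, div_self hKr.ne',
      intervalIntegral.integral_of_le zero_le_one, integral_Ioc_eq_integral_Ioo]
  rw [e, Finset.sum_mul]
  refine norm_sum_le_of_le _ fun k hk => ?_
  have hk' := Finset.mem_range.1 hk
  refine (hb k hk' z fun t ht => hz t ⟨(hmem k hk'.le).1.trans ht.1,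
    ht.2.trans (hmem (k + 1) hk').2⟩).trans ?_
  rw [mul_assoc]
  refine mul_le_mul_of_nonneg_left ?_ (hC k)
  have hterm : ∀ l ≤ K, ‖γ (l / K) - z‖ ^ (-(1 / 4) : ℝ) ≤
      ∑ w ∈ P, ‖w - z‖ ^ (-(1 / 4) : ℝ) := fun l hl =>
    Finset.single_le_sum (f := fun w => ‖w - z‖ ^ (-(1 / 4) : ℝ)) (fun _ _ => by positivity)
      (Finset.mem_image.2 ⟨l, Finset.mem_range.2 (by omega), rfl⟩)
  have h1 := hterm k hk'.le
  have h2 := hterm (k + 1) hk'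
  have := norm_nonneg z
  unfold weakSing
  linarith

/-- On each graph piece `‖w - γ t‖` is at least a multiple of `|t - s|` for some `s`, wherever `w`
lies. The square of a singular term is thus dominated by the integrable `|t - s|^(-1/2)`. -/
theorem memLp_weakSing (hγ : ContDiff ℝ 1 γ) (hr : ∀ t ∈ Icc (0 : ℝ) 1, deriv γ t ≠ 0)
    (P : Finset ℂ) : MemLp (fun t => weakSing P (γ t)) 2 unitMeasure := by
  have hfin : IsProbabilityMeasure unitMeasure := ⟨by simp⟩
  refine MemLp.add ?_ (memLp_finsetSum _ fun w _ => ?_)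
  · obtain ⟨M, hM⟩ := (isCompact_Icc (a := (0 : ℝ)) (b := 1)).exists_bound_of_continuousOn
      (f := fun t => 1 + ‖γ t‖) (continuous_const.add hγ.continuous.norm).continuousOn
    exact MemLp.of_bound (continuous_const.add hγ.continuous.norm).aestronglyMeasurable M
      ((ae_restrict_mem measurableSet_Ioo).mono fun t ht => hM t (Ioo_subset_Icc_self ht))
  have hmeas : ∀ r : ℝ, Measurable fun t => ‖w - γ t‖ ^ r := fun r =>
    ((hγ.continuous.measurable.const_sub w).norm).pow_const r
  rw [memLp_two_iff_integrable_sq_norm (hmeas _).aestronglyMeasurable]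
  have e : ∀ t, ‖‖w - γ t‖ ^ (-(1 / 4) : ℝ)‖ ^ 2 = ‖w - γ t‖ ^ (-(1 / 2) : ℝ) := fun t => by
    rw [Real.norm_of_nonneg (by positivity), ← Real.rpow_mul_natCast (norm_nonneg _)]
    norm_num
  simp only [e]
  obtain ⟨K, hK0, hK⟩ := exists_graph_partition hγ hr
  have hKr : (0 : ℝ) < K := by exact_mod_cast hK0
  have hmem : ∀ k ≤ K, (k : ℝ) / K ∈ Icc (0 : ℝ) 1 := fun k hk =>
    ⟨by positivity, (div_le_one hKr).2 (by exact_mod_cast hk)⟩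
  have hle : ∀ k : ℕ, (k : ℝ) / K ≤ (k + 1 : ℕ) / K := fun k => by gcongr; simp
  have hi : ∀ k < K, IntervalIntegrable (fun t => ‖w - γ t‖ ^ (-(1 / 2) : ℝ)) volume
      (k / K : ℝ) ((k + 1 : ℕ) / K) := fun k hk => by
    obtain ⟨s, hs, hsb⟩ := exists_mul_abs_sub_le hγ (hle k) (hK k hk) w
    set ρ := deriv γ (k / K) with hρ
    have hρ0 : 0 < ‖ρ‖ := norm_pos_iff.2 (hr _ (hmem k hk.le))
    refine ((intervalIntegrable_abs_sub_rpow (r := -(1 / 2)) (by norm_num) s _ _).const_mul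
      ((1 / 2 * ‖ρ‖) ^ (-(1 / 2) : ℝ))).mono_fun' (hmeas _).aestronglyMeasurable ?_
    have hne : ∀ᵐ t : ℝ, t ≠ s := by simp [ae_iff, measure_singleton]
    refine (ae_restrict_iff' measurableSet_uIoc).2 ?_
    filter_upwards [hne] with t hts ht
    rw [uIoc_of_le (hle k)] at ht
    have h1 := hsb t (Ioc_subset_Icc_self ht)
    rw [le_div_iff₀ hρ0] at h1
    have h2 : 0 < |t - s| := abs_pos.2 (sub_ne_zero.2 hts)
    rw [Real.norm_of_nonneg (by positivity), ← Real.mul_rpow (by positivity) (abs_nonneg _)]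
    refine Real.rpow_le_rpow_of_nonpos (by positivity) ?_ (by norm_num)
    rw [norm_sub_rev]
    linarith
  have := IntervalIntegrable.trans_iterate (a := fun k : ℕ => (k / K : ℝ)) hi
  simp only [Nat.cast_zero, zero_div, div_self hKr.ne'] at this
  exact ((intervalIntegrable_iff_integrableOn_Ioc_of_le zero_le_one).1 this).mono_set
    Ioo_subset_Ioc_self

end Curve

/-! ### The whole contour: nontangential limits of the Cauchy integral -/

variable {Γ : Contour}

theorem param_eq_imp {i j : Fin Γ.ℓ} {s t : ℝ} (hs : s ∈ Ioo (0 : ℝ) 1) (ht : t ∈ Icc (0 : ℝ) 1)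
    (h : Γ.γ j t = Γ.γ i s) : j = i ∧ t = s := by
  rcases Γ.meet i j s (Ioo_subset_Icc_self hs) t ht h.symm with h1 | h1
  · exact ⟨h1.1.symm, h1.2.symm⟩
  · rcases h1.1 with h2 | h2
    · exact absurd h2 hs.1.ne'
    · exact absurd h2 hs.2.ne

theorem cauchy_congr {u v : Γ.Pt → Mat} (h : u =ᵐ[Γ.arcLength] v) (z : ℂ) :
    Γ.cauchy u z = Γ.cauchy v z := by
  unfold cauchy
  congr 1
  refine Finset.sum_congr rfl fun i _ => integral_congr_ae ?_
  filter_upwards [Γ.ae_arcLength_iff.1 h i] with t ht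
  rw [ht]

theorem nontangential_eq (left : Bool) (i : Fin Γ.ℓ) (t : ℝ) :
    Γ.nontangential left (i, t) = ⨆ m : ℕ, 𝓝[cone (Γ.γ i) left t m] (Γ.γ i t) := rfl

/-- The approach to a point of the contour along the normal. -/
noncomputable def normalApproach (left : Bool) (p : Γ.Pt) (n : ℕ) : ℂ :=
  Γ.γ p.1 p.2 + (((if left then 1 else -1) * (1 / (n + 1)) : ℝ) : ℂ) *
    (Complex.I * deriv (Γ.γ p.1) p.2)

theorem tendsto_normalApproach_cone (left : Bool) {i : Fin Γ.ℓ} {t : ℝ} (ht : t ∈ Ioo (0 : ℝ) 1) :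
    Tendsto (normalApproach left (i, t)) atTop (𝓝[cone (Γ.γ i) left t 0] (Γ.γ i t)) := by
  have hp : deriv (Γ.γ i) t ≠ 0 := Γ.regular i t (Ioo_subset_Icc_self ht)
  refine tendsto_nhdsWithin_iff.2 ⟨?_, Eventually.of_forall fun n => ?_⟩
  · have h1 := (tendsto_one_div_add_atTop_nhds_zero_nat (𝕜 := ℝ)).const_mul
      (if left then 1 else -1 : ℝ)
    have h2 := ((Complex.continuous_ofReal.tendsto _).comp h1).mul_const
      (Complex.I * deriv (Γ.γ i) t)
    have h3 := h2.const_add (Γ.γ i t)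
    change Tendsto (fun n => normalApproach left (i, t) n) atTop _
    simpa [normalApproach, Function.comp_def] using h3
  · have e : (normalApproach left (i, t) n - Γ.γ i t) / deriv (Γ.γ i) t =
        (((if left then 1 else -1) * (1 / (n + 1)) : ℝ) : ℂ) * Complex.I := by
      simp only [normalApproach]; field_simp; ring
    simp only [cone, mem_ofPred_eq, e]
    have hn : (0 : ℝ) < 1 / (n + 1) := by positivity
    rw [Complex.re_ofReal_mul, Complex.im_ofReal_mul]
    cases left <;> simp <;> positivity

theorem tendsto_normalApproach (left : Bool) {i : Fin Γ.ℓ} {t : ℝ} (ht : t ∈ Ioo (0 : ℝ) 1) :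
    Tendsto (normalApproach left (i, t)) atTop (Γ.nontangential left (i, t)) :=
  (tendsto_normalApproach_cone left ht).mono_right
    (le_iSup (fun m : ℕ => 𝓝[cone (Γ.γ i) left t m] (Γ.γ i t)) 0)

theorem nontangential_neBot (left : Bool) {i : Fin Γ.ℓ} {t : ℝ} (ht : t ∈ Ioo (0 : ℝ) 1) :
    (Γ.nontangential left (i, t)).NeBot := (tendsto_normalApproach left ht).neBot

theorem nontangential_le_nhds (left : Bool) (i : Fin Γ.ℓ) (t : ℝ) :
    Γ.nontangential left (i, t) ≤ 𝓝 (Γ.γ i t) := by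
  rw [nontangential_eq]; exact iSup_le fun m => nhdsWithin_le_nhds

theorem eventually_notMem_carrier (left : Bool) {i : Fin Γ.ℓ} {t : ℝ} (ht : t ∈ Ioo (0 : ℝ) 1) :
    ∀ᶠ z in Γ.nontangential left (i, t), z ∉ Γ.carrier := by
  have hj : ∀ j, ∀ᶠ z in Γ.nontangential left (i, t), ∀ s ∈ Icc (0 : ℝ) 1, Γ.γ j s ≠ z := by
    intro j
    rcases eq_or_ne j i with rfl | hji
    · rw [nontangential_eq]
      -- The zero density serves only to extract the statement that the cone avoids the curve.
      refine eventually_iSup.2 fun m => (exists_tendsto_cone (E := ℂ) (v := fun _ => 0) (H := 0)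
        (Γ.contDiff_one j) ht (Γ.regular j t (Ioo_subset_Icc_self ht))
        (fun s hs h => (param_eq_imp ht hs h).2) (by simp) left m).1
    · exact nontangential_le_nhds left i t (eventually_forall_ne (Γ.continuous_γ j) isCompact_Icc
        fun s hs h => hji (param_eq_imp ht hs h).1)
  filter_upwards [eventually_all.2 hj] with z hz ⟨j, s, hs, h⟩ using hz j s hs h.symm

/-- The component through the point has limits in cones; the others stay at positive distance. All
apertures share one limit, because each cone contains that of aperture 0, which still accumulates at
the point. -/
theorem exists_tendsto_cauchy {u : Γ.Pt → Mat} (hu : Γ.MemSobolev 2 1 u) (left : Bool)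
    {i : Fin Γ.ℓ} {t : ℝ} (ht : t ∈ Ioo (0 : ℝ) 1) :
    ∃ L, Tendsto (Γ.cauchy u) (Γ.nontangential left (i, t)) (𝓝 L) := by
  choose v H hH hv hvh using hu.exists_holder
  have hm : ∀ m : ℕ, ∃ L, Tendsto (Γ.cauchy u) (𝓝[cone (Γ.γ i) left t m] (Γ.γ i t)) (𝓝 L) := by
    intro m
    have hj : ∀ j, ∃ L, Tendsto (fun z => ∫ s in Ioo (0 : ℝ) 1,
        (deriv (Γ.γ j) s / (Γ.γ j s - z)) • u (j, s)) (𝓝[cone (Γ.γ i) left t m] (Γ.γ i t))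
        (𝓝 L) := by
      intro j
      have e : ∀ z, ∫ s in Ioo (0 : ℝ) 1, (deriv (Γ.γ j) s / (Γ.γ j s - z)) • u (j, s) =
          ∫ s in Ioo (0 : ℝ) 1, (deriv (Γ.γ j) s / (Γ.γ j s - z)) • v j s := fun z =>
        integral_congr_ae ((hv j).mono fun s hs => by simp only [hs])
      simp only [e]
      rcases eq_or_ne j i with rfl | hji
      · exact (exists_tendsto_cone (Γ.contDiff_one j) ht
          (Γ.regular j t (Ioo_subset_Icc_self ht)) (fun s hs h => (param_eq_imp ht hs h).2)
          (hvh j) left m).2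
      · obtain ⟨d, hd, hdist⟩ := exists_dist_pos (Γ.continuous_γ j) isCompact_Icc
          (fun s hs h => hji (param_eq_imp ht hs h).1)
        have := (differentiableAt_cauchyIntegral (Γ.contDiff_one j) measurableSet_Ioo
          Ioo_subset_Icc_self ((continuousOn_of_holder (hvh j)).integrableOn_Icc.mono_set
            Ioo_subset_Icc_self) hd fun s hs => hdist s (Ioo_subset_Icc_self hs)).continuousAt
        exact ⟨_, this.tendsto.mono_left nhdsWithin_le_nhds⟩
    choose L hL using hj
    exact ⟨_, (tendsto_finsetSum _ fun j _ => hL j).const_smul _⟩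
  choose L hL using hm
  have hmono : ∀ m : ℕ, 𝓝[cone (Γ.γ i) left t 0] (Γ.γ i t) ≤ 𝓝[cone (Γ.γ i) left t m] (Γ.γ i t) :=
    fun m => nhdsWithin_mono _ fun z hz => ⟨hz.1, hz.2.trans (by gcongr; simp)⟩
  have hne := (tendsto_normalApproach_cone (i := i) left ht).neBot
  refine ⟨L 0, ?_⟩
  rw [nontangential_eq]
  refine tendsto_iSup.2 fun m => ?_
  rw [tendsto_nhds_unique (hL 0) ((hL m).mono_left (hmono m))]
  exact hL m


variable {Γ : Contour}

theorem ne_of_notMem_carrier {z : ℂ} (hz : z ∉ Γ.carrier) (i : Fin Γ.ℓ) :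
    ∀ t ∈ Icc (0 : ℝ) 1, Γ.γ i t ≠ z := fun t ht h => hz ⟨i, t, ht, h.symm⟩

/-! ### Boundary values of the Cauchy integral of an `H¹` density -/

theorem exists_norm_cauchy_le_weakSing {u : Γ.Pt → Mat} (hu : Γ.MemSobolev 2 1 u) :
    ∃ C, 0 ≤ C ∧ ∃ P : Finset ℂ, ∀ z ∉ Γ.carrier, ‖Γ.cauchy u z‖ ≤ C * weakSing P z := by
  classical
  choose v H hH hv hvh using hu.exists_holder
  choose C hC P hP using fun i =>
    exists_norm_cauchyIntegral_le_weakSing (Γ.contDiff_one i) (Γ.regular i) (hH i) (hvh i)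
  refine ⟨‖(2 * (Real.pi : ℂ) * Complex.I)⁻¹‖ * ∑ i, C i,
    mul_nonneg (norm_nonneg _) (Finset.sum_nonneg fun i _ => hC i),
    Finset.univ.biUnion P, fun z hz => ?_⟩
  rw [cauchy, norm_smul, mul_assoc ‖(2 * (Real.pi : ℂ) * Complex.I)⁻¹‖]
  gcongr
  rw [Finset.sum_mul]
  refine norm_sum_le_of_le _ fun i _ => ?_
  have e : ∫ s in Ioo (0 : ℝ) 1, (deriv (Γ.γ i) s / (Γ.γ i s - z)) • u (i, s) =
      ∫ s in Ioo (0 : ℝ) 1, (deriv (Γ.γ i) s / (Γ.γ i s - z)) • v i s :=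
    integral_congr_ae ((hv i).mono fun s hs => by simp only [hs])
  rw [e]
  exact (hP i z (ne_of_notMem_carrier hz i)).trans (mul_le_mul_of_nonneg_left
    (weakSing_mono (Finset.subset_biUnion_of_mem P (Finset.mem_univ i)) z) (hC i))

theorem ae_mem_Ioo : ∀ᵐ p ∂Γ.arcLength, p.2 ∈ Ioo (0 : ℝ) 1 :=
  Γ.ae_arcLength_iff.2 fun _ => ae_restrict_mem measurableSet_Ioo

theorem ae_notMem_finset (P : Finset ℂ) : ∀ᵐ p ∂Γ.arcLength, Γ.γ p.1 p.2 ∉ P := by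
  refine Γ.ae_arcLength_iff.2 fun i => ?_
  have hinj : InjOn (Γ.γ i) (Ioo 0 1) := fun s hs t ht h =>
    (param_eq_imp hs (Ioo_subset_Icc_self ht) h.symm).2.symm
  have hfin : (Ioo (0 : ℝ) 1 ∩ Γ.γ i ⁻¹' (P : Set ℂ)).Finite := by
    refine Finite.of_finite_image (P.finite_toSet.subset ?_) (hinj.mono inter_subset_left)
    rintro _ ⟨t, ht, rfl⟩
    exact ht.2
  have h0 := hfin.measure_zero volume
  rw [ae_restrict_iff' measurableSet_Ioo]
  filter_upwards [compl_mem_ae_iff.2 h0] with t ht h1 h2 using ht ⟨h1, h2⟩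

theorem tendsto_boundaryValue {u : Γ.Pt → Mat} (hu : Γ.MemSobolev 2 1 u) (left : Bool) {p : Γ.Pt}
    (hp : p.2 ∈ Ioo (0 : ℝ) 1) :
    Tendsto (Γ.cauchy u) (Γ.nontangential left p) (𝓝 (Γ.boundaryValue left (Γ.cauchy u) p)) := by
  obtain ⟨i, t⟩ := p
  exact tendsto_nhds_limUnder (exists_tendsto_cauchy hu left hp)

theorem boundaryValue_eq {Φ : ℂ → Mat} {left : Bool} {p : Γ.Pt} {L : Mat}
    (hp : p.2 ∈ Ioo (0 : ℝ) 1) (h : Tendsto Φ (Γ.nontangential left p) (𝓝 L)) :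
    Γ.boundaryValue left Φ p = L := by
  obtain ⟨i, t⟩ := p
  have := nontangential_neBot left hp (i := i)
  exact h.limUnder_eq

theorem measurable_normalApproach (left : Bool) (n : ℕ) :
    Measurable fun p : Γ.Pt => normalApproach left p n := by
  refine Γ.measurable_uncurried (f := fun i t => normalApproach left (i, t) n) fun i => ?_
  exact (Γ.continuous_γ i).measurable.add
    (measurable_const.mul ((Γ.continuous_deriv i).measurable.const_mul _))

theorem stronglyMeasurable_cauchy {u : Γ.Pt → Mat} (hu : StronglyMeasurable u) {a : Γ.Pt → ℂ}
    (ha : Measurable a) : StronglyMeasurable fun p => Γ.cauchy u (a p) := by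
  have h : StronglyMeasurable fun p => ∑ j, ∫ t in Ioo (0 : ℝ) 1,
      (deriv (Γ.γ j) t / (Γ.γ j t - a p)) • u (j, t) := by
    refine Finset.stronglyMeasurable_fun_sum _ fun j _ => ?_
    have hk : Measurable fun q : Γ.Pt × ℝ => deriv (Γ.γ j) q.2 / (Γ.γ j q.2 - a q.1) :=
      ((Γ.continuous_deriv j).measurable.comp measurable_snd).div
        (((Γ.continuous_γ j).measurable.comp measurable_snd).sub (ha.comp measurable_fst))
    exact StronglyMeasurable.integral_prod_right' (ν := unitMeasure)
      (f := fun q : Γ.Pt × ℝ => (deriv (Γ.γ j) q.2 / (Γ.γ j q.2 - a q.1)) • u (j, q.2))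
      (hk.stronglyMeasurable.smul
        (hu.comp_measurable (measurable_prodMk_left.comp measurable_snd)))
  exact h.const_smul (2 * (Real.pi : ℂ) * Complex.I)⁻¹

/-- Along the normals the boundary value is a pointwise limit of a sequence of measurable functions,
hence measurable, and it inherits the weakly singular bound, which is continuous off finitely many
points. -/
theorem memLp_boundaryValue {u : Γ.L2} (hu : Γ.MemSobolev 2 1 u) (left : Bool) :
    MemLp (Γ.boundaryValue left (Γ.cauchy u)) 2 Γ.arcLength := by
  have hlim : ∀ᵐ p ∂Γ.arcLength, Tendsto (fun n => Γ.cauchy u (normalApproach left p n)) atTop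
      (𝓝 (Γ.boundaryValue left (Γ.cauchy u) p)) := by
    filter_upwards [ae_mem_Ioo] with ⟨i, t⟩ ht
    exact (tendsto_boundaryValue hu left ht).comp (tendsto_normalApproach left ht)
  have hmeas := aestronglyMeasurable_of_tendsto_ae atTop (fun n => (stronglyMeasurable_cauchy
    (Lp.stronglyMeasurable u) (measurable_normalApproach left n)).aestronglyMeasurable) hlim
  obtain ⟨C, hC, P, hP⟩ := exists_norm_cauchy_le_weakSing hu
  have hdom : MemLp (fun p : Γ.Pt => weakSing P (Γ.γ p.1 p.2)) 2 Γ.arcLength :=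
    Γ.memLp_of_slices fun i => memLp_weakSing (Γ.contDiff_one i) (Γ.regular i) P
  refine hdom.of_le_mul (c := C) hmeas ?_
  filter_upwards [ae_mem_Ioo, hlim, ae_notMem_finset P] with ⟨i, t⟩ ht hl hPt
  rw [Real.norm_of_nonneg (weakSing_nonneg _ _)]
  have hna := tendsto_normalApproach (Γ := Γ) left ht (i := i)
  have hev := hna.eventually (eventually_notMem_carrier left ht)
  exact le_of_tendsto_of_tendsto hl.norm (((continuousAt_weakSing hPt).tendsto.comp
    (hna.mono_right (nontangential_le_nhds left i t))).const_mul C)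
    (hev.mono fun n hn => hP _ hn)

/-! ### Linearity -/

theorem norm_kernel_le_of_dist (i : Fin Γ.ℓ) : ∃ M, 0 ≤ M ∧ ∀ d > 0, ∀ z,
    (∀ w ∈ Γ.carrier, d ≤ ‖z - w‖) → ∀ t ∈ Icc (0 : ℝ) 1,
      ‖deriv (Γ.γ i) t / (Γ.γ i t - z)‖ ≤ M / d := by
  obtain ⟨_, _, M, hM, h⟩ := Γ.exists_norm_deriv_bounds i
  refine ⟨M, hM.le, fun d hd z hz t ht => norm_kernel_le (h t ht).2 hd ?_⟩
  rw [norm_sub_rev]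
  exact hz _ ⟨i, t, ht, rfl⟩

theorem isCompact_carrier : IsCompact Γ.carrier := by
  have : Γ.carrier = ⋃ i, Γ.γ i '' Icc 0 1 := by
    ext z
    simp only [carrier, mem_ofPred_eq, mem_iUnion, mem_image]
    exact exists_congr fun i => exists_congr fun t => and_congr_right fun _ => eq_comm
  rw [this]
  exact isCompact_iUnion fun i => isCompact_Icc.image (Γ.continuous_γ i)

theorem exists_dist_carrier {z : ℂ} (hz : z ∉ Γ.carrier) :
    ∃ d > 0, ∀ w ∈ Γ.carrier, d ≤ ‖z - w‖ := by
  obtain ⟨d, hd, h⟩ := Metric.isOpen_iff.1 (isCompact_carrier (Γ := Γ)).isClosed.isOpen_compl z hz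
  refine ⟨d, hd, fun w hw => ?_⟩
  by_contra hlt
  exact h (by rw [Metric.mem_ball, dist_comm, dist_eq_norm]; exact not_le.1 hlt) hw

theorem integrable_kernel_smul {u : Γ.Pt → Mat} (hu : Integrable u Γ.arcLength) {z : ℂ}
    (hz : z ∉ Γ.carrier) (i : Fin Γ.ℓ) :
    Integrable (fun t => (deriv (Γ.γ i) t / (Γ.γ i t - z)) • u (i, t)) unitMeasure := by
  obtain ⟨d, hd, hdist⟩ := exists_dist_carrier hz
  obtain ⟨M, -, h⟩ := norm_kernel_le_of_dist i
  refine (integrable_slice hu i).bdd_smul (M / d) ((Γ.continuous_deriv i).measurable.div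
    ((Γ.continuous_γ i).measurable.sub_const z)).aestronglyMeasurable ?_
  filter_upwards [ae_restrict_mem measurableSet_Ioo] with t ht
  exact h d hd z hdist t (Ioo_subset_Icc_self ht)

theorem cauchy_add {u v : Γ.Pt → Mat} (hu : Integrable u Γ.arcLength)
    (hv : Integrable v Γ.arcLength) {z : ℂ} (hz : z ∉ Γ.carrier) :
    Γ.cauchy (u + v) z = Γ.cauchy u z + Γ.cauchy v z := by
  unfold cauchy
  rw [← smul_add, ← Finset.sum_add_distrib]
  congr 1
  refine Finset.sum_congr rfl fun i _ => ?_
  rw [← integral_add (integrable_kernel_smul hu hz i) (integrable_kernel_smul hv hz i)]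
  simp only [Pi.add_apply, smul_add]

theorem cauchy_smul (c : ℂ) (u : Γ.Pt → Mat) (z : ℂ) :
    Γ.cauchy (c • u) z = c • Γ.cauchy u z := by
  have e : ∀ i, ∫ t in Ioo (0 : ℝ) 1, (deriv (Γ.γ i) t / (Γ.γ i t - z)) • (c • u) (i, t) =
      c • ∫ t in Ioo (0 : ℝ) 1, (deriv (Γ.γ i) t / (Γ.γ i t - z)) • u (i, t) := fun i => by
    rw [← integral_smul]
    simp only [Pi.smul_apply, smul_comm c]
  simp only [cauchy, e, ← Finset.smul_sum]
  exact smul_comm _ _ _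

theorem integrable_coe (u : Γ.L2) : Integrable u Γ.arcLength :=
  (Lp.memLp u).integrable (by norm_num)

theorem cauchy_coe_add (u v : Γ.L2) {z : ℂ} (hz : z ∉ Γ.carrier) :
    Γ.cauchy (u + v : Γ.L2) z = Γ.cauchy u z + Γ.cauchy v z := by
  rw [cauchy_congr (Lp.coeFn_add u v), cauchy_add (integrable_coe u) (integrable_coe v) hz]

theorem cauchy_coe_smul (c : ℂ) (u : Γ.L2) (z : ℂ) :
    Γ.cauchy (c • u : Γ.L2) z = c • Γ.cauchy u z := by
  rw [cauchy_congr (Lp.coeFn_smul c u), cauchy_smul]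

theorem cauchy_coe_sub (u v : Γ.L2) {z : ℂ} (hz : z ∉ Γ.carrier) :
    Γ.cauchy (u - v : Γ.L2) z = Γ.cauchy u z - Γ.cauchy v z := by
  rw [eq_sub_iff_add_eq, ← cauchy_coe_add _ _ hz, sub_add_cancel]

theorem boundaryValue_coe_add {u v : Γ.L2} (hu : Γ.MemSobolev 2 1 u) (hv : Γ.MemSobolev 2 1 v)
    (left : Bool) : Γ.boundaryValue left (Γ.cauchy (u + v : Γ.L2)) =ᵐ[Γ.arcLength]
      Γ.boundaryValue left (Γ.cauchy u) + Γ.boundaryValue left (Γ.cauchy v) := by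
  filter_upwards [ae_mem_Ioo] with p hp
  refine boundaryValue_eq hp (((tendsto_boundaryValue hu left hp).add
    (tendsto_boundaryValue hv left hp)).congr' ?_)
  obtain ⟨i, t⟩ := p
  filter_upwards [eventually_notMem_carrier left hp] with z hz using (cauchy_coe_add u v hz).symm

theorem boundaryValue_coe_smul {u : Γ.L2} (hu : Γ.MemSobolev 2 1 u) (c : ℂ)
    (left : Bool) : Γ.boundaryValue left (Γ.cauchy (c • u : Γ.L2)) =ᵐ[Γ.arcLength]
      c • Γ.boundaryValue left (Γ.cauchy u) := by
  filter_upwards [ae_mem_Ioo] with p hp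
  exact boundaryValue_eq hp (((tendsto_boundaryValue hu left hp).const_smul c).congr
    fun z => (cauchy_coe_smul c u z).symm)

theorem boundaryValue_one_add {u : Γ.L2} (hu : Γ.MemSobolev 2 1 u) (left : Bool) :
    Γ.boundaryValue left (fun z => 1 + Γ.cauchy u z) =ᵐ[Γ.arcLength]
      fun p => 1 + Γ.boundaryValue left (Γ.cauchy u) p := by
  filter_upwards [ae_mem_Ioo] with p hp
  exact boundaryValue_eq hp ((tendsto_boundaryValue hu left hp).const_add 1)

/-! ### Boundary values and multiplication as linear maps into `L²` -/

theorem toL2_eq {f : Γ.Pt → Mat} (hf : MemLp f 2 Γ.arcLength) : Γ.toL2 f = hf.toLp f := dif_pos hf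

theorem coeFn_toL2 {f : Γ.Pt → Mat} (hf : MemLp f 2 Γ.arcLength) :
    Γ.toL2 f =ᵐ[Γ.arcLength] f := by
  rw [toL2_eq hf]; exact hf.coeFn_toLp

theorem toL2_congr {f g : Γ.Pt → Mat} (hf : MemLp f 2 Γ.arcLength) (h : f =ᵐ[Γ.arcLength] g) :
    Γ.toL2 f = Γ.toL2 g := by
  rw [toL2_eq hf, toL2_eq (hf.ae_eq h)]
  exact (MemLp.toLp_eq_toLp_iff _ _).2 h

theorem toL2_add {f g : Γ.Pt → Mat} (hf : MemLp f 2 Γ.arcLength) (hg : MemLp g 2 Γ.arcLength) :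
    Γ.toL2 (f + g) = Γ.toL2 f + Γ.toL2 g := by
  rw [toL2_eq hf, toL2_eq hg, toL2_eq (hf.add hg)]; rfl

theorem toL2_sub {f g : Γ.Pt → Mat} (hf : MemLp f 2 Γ.arcLength) (hg : MemLp g 2 Γ.arcLength) :
    Γ.toL2 (f - g) = Γ.toL2 f - Γ.toL2 g := by
  rw [toL2_eq hf, toL2_eq hg, toL2_eq (hf.sub hg)]; rfl

theorem toL2_smul {f : Γ.Pt → Mat} (hf : MemLp f 2 Γ.arcLength) (c : ℂ) :
    Γ.toL2 (c • f) = c • Γ.toL2 f := by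
  rw [toL2_eq hf, toL2_eq (hf.const_smul c)]; rfl

/-- The boundary values of the Cauchy integral, as a linear map on a space of `H¹` densities. -/
noncomputable def boundaryMap (left : Bool) (X : Submodule ℂ Γ.L2)
    (hX : ∀ u ∈ X, Γ.MemSobolev 2 1 u) : X →ₗ[ℂ] Γ.L2 where
  toFun u := Γ.toL2 (Γ.boundaryValue left (Γ.cauchy u))
  map_add' u v := by
    have hu := hX u u.2
    have hv := hX v v.2
    rw [← toL2_add (memLp_boundaryValue hu left) (memLp_boundaryValue hv left)]
    exact toL2_congr (memLp_boundaryValue (hX _ (u + v).2) left) (boundaryValue_coe_add hu hv left)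
  map_smul' c u := by
    have hu := hX u u.2
    rw [RingHom.id_apply, ← toL2_smul (memLp_boundaryValue hu left)]
    exact toL2_congr (memLp_boundaryValue (hX _ (c • u).2) left) (boundaryValue_coe_smul hu c left)

theorem memLp_coe_mul {F : Γ.Pt → Mat} (hF : MemLp F ⊤ Γ.arcLength) (f : Γ.L2) :
    MemLp (fun p => f p * F p) 2 Γ.arcLength :=
  hF.mul' (Lp.memLp f)

/-- Multiplication from the right by a bounded function. -/
noncomputable def mulRight {F : Γ.Pt → Mat} (hF : MemLp F ⊤ Γ.arcLength) : Γ.L2 →ₗ[ℂ] Γ.L2 where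
  toFun f := Γ.toL2 fun p => f p * F p
  map_add' f g := by
    rw [← toL2_add (memLp_coe_mul hF f) (memLp_coe_mul hF g)]
    refine toL2_congr (memLp_coe_mul hF (f + g)) ?_
    filter_upwards [Lp.coeFn_add f g] with p hp
    simp only [hp, Pi.add_apply, add_mul]
  map_smul' c f := by
    rw [RingHom.id_apply, ← toL2_smul (memLp_coe_mul hF f)]
    refine toL2_congr (memLp_coe_mul hF (c • f)) ?_
    filter_upwards [Lp.coeFn_smul c f] with p hp
    simp only [hp, Pi.smul_apply, smul_mul_assoc]

/-- Both sides multiply the same element `𝒞⁻ u`, so linearity in `u` plays no role. The form `1 + (F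
- G)` makes the difference a jump to which the bounds of the method apply. -/
theorem opT_sub_opT {F G : Γ.Pt → Mat} (hF : MemLp (fun p => F p - 1) ⊤ Γ.arcLength)
    (hG : MemLp (fun p => G p - 1) ⊤ Γ.arcLength) (u : Γ.L2) :
    Γ.opT F u - Γ.opT G u = Γ.opT (fun p => 1 + (F p - G p)) u := by
  unfold opT
  rw [← toL2_sub (memLp_coe_mul hF _) (memLp_coe_mul hG _)]
  congr 1
  funext p
  simp only [Pi.sub_apply, ← mul_sub]
  congr 1
  abel

/-! ### The Cauchy integral away from the contour -/

theorem exists_norm_cauchy_le : ∃ C, 0 ≤ C ∧ ∀ d > 0, ∀ (u : Γ.L2) (z : ℂ),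
    (∀ w ∈ Γ.carrier, d ≤ ‖z - w‖) → ‖Γ.cauchy u z‖ ≤ C / d * ‖u‖ := by
  choose M hM hk using norm_kernel_le_of_dist (Γ := Γ)
  choose D hD hu using Γ.exists_integral_slice_le
  refine ⟨‖(2 * (Real.pi : ℂ) * Complex.I)⁻¹‖ * ∑ i, M i * D i, mul_nonneg (norm_nonneg _)
    (Finset.sum_nonneg fun i _ => mul_nonneg (hM i) (hD i)), fun d hd u z hz => ?_⟩
  rw [cauchy, norm_smul, mul_div_assoc, mul_assoc ‖(2 * (Real.pi : ℂ) * Complex.I)⁻¹‖]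
  gcongr
  rw [Finset.sum_div, Finset.sum_mul]
  refine norm_sum_le_of_le _ fun i _ => ?_
  have hint := integrable_slice (integrable_coe u) i
  refine (norm_integral_le_of_norm_le (hint.norm.const_mul (M i / d)) ?_).trans ?_
  · filter_upwards [ae_restrict_mem measurableSet_Ioo] with t ht
    rw [norm_smul]
    gcongr
    exact hk i d hd z hz t (Ioo_subset_Icc_self ht)
  · rw [integral_const_mul, mul_div_right_comm, mul_assoc]
    have := hM i
    gcongr
    exact hu i u

theorem differentiableAt_cauchy (u : Γ.L2) {z : ℂ} (hz : z ∉ Γ.carrier) :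
    DifferentiableAt ℂ (Γ.cauchy u) z := by
  obtain ⟨d, hd, hdist⟩ := exists_dist_carrier hz
  have h : DifferentiableAt ℂ (fun z => ∑ i, ∫ t in Ioo (0 : ℝ) 1,
      (deriv (Γ.γ i) t / (Γ.γ i t - z)) • u (i, t)) z := by
    refine DifferentiableAt.fun_sum fun i _ => ?_
    refine differentiableAt_cauchyIntegral (Γ.contDiff_one i) measurableSet_Ioo
      Ioo_subset_Icc_self (integrable_slice (integrable_coe u) i) hd fun t ht => ?_
    rw [norm_sub_rev]
    exact hdist _ ⟨i, t, Ioo_subset_Icc_self ht, rfl⟩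
  exact h.const_smul (2 * (Real.pi : ℂ) * Complex.I)⁻¹

/-- Cauchy's estimates on discs of radius `δ / 2` about the points of `S`, which keep distance `δ /
2` from `Γ`. The constant sums the contributions of all orders up to `j`; the summand 1 makes it
positive. -/
theorem exists_wInfNorm_sub_le (j : ℕ) {S : Set ℂ} (hS : Γ.BoundedAway S) :
    ∃ C > 0, ∀ u v : Γ.L2, wInfNorm j S (fun z => (1 + Γ.cauchy u z) - (1 + Γ.cauchy v z)) ≤
      ENNReal.ofReal (C * ‖u - v‖) := by
  obtain ⟨δ, hδ, hdist⟩ := hS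
  obtain ⟨A, hA, hbound⟩ := exists_norm_cauchy_le (Γ := Γ)
  set R := δ / 2 with hR
  have hR0 : 0 < R := half_pos hδ
  have hterm : ∀ m : ℕ, 0 ≤ m.factorial * (A / R) / R ^ m := fun m => by positivity
  refine ⟨1 + ∑ m ∈ Finset.range (j + 1), m.factorial * (A / R) / R ^ m,
    add_pos_of_pos_of_nonneg one_pos (Finset.sum_nonneg fun m _ => hterm m), fun u v => ?_⟩
  refine iSup₂_le fun m hm => iSup₂_le fun z hz => ?_
  have hball : ∀ x ∈ Metric.closedBall z R, ∀ w ∈ Γ.carrier, R ≤ ‖x - w‖ := fun x hx w hw => by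
    have h1 := hdist z hz w hw
    have h2 := norm_add_le (z - x) (x - w)
    rw [sub_add_sub_cancel] at h2
    rw [Metric.mem_closedBall, dist_comm, dist_eq_norm] at hx
    linarith
  have hoff : ∀ x ∈ Metric.closedBall z R, x ∉ Γ.carrier := fun x hx hxc => by
    have := hball x hx x hxc
    rw [sub_self, norm_zero] at this
    linarith
  have e : (fun z => (1 + Γ.cauchy u z) - (1 + Γ.cauchy v z)) =ᶠ[𝓝 z]
      Γ.cauchy (u - v : Γ.L2) := by
    filter_upwards [Metric.closedBall_mem_nhds z hR0] with x hx
    rw [cauchy_coe_sub u v (hoff x hx)]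
    abel
  rw [e.iteratedDeriv_eq m, ← ofReal_norm]
  refine ENNReal.ofReal_le_ofReal ?_
  have hd : DiffContOnCl ℂ (Γ.cauchy (u - v : Γ.L2)) (Metric.ball z R) :=
    DifferentiableOn.diffContOnCl fun x hx => (differentiableAt_cauchy (u - v)
      (hoff x (Metric.closure_ball_subset_closedBall hx))).differentiableWithinAt
  refine (Complex.norm_iteratedDeriv_le_of_forall_mem_sphere_norm_le m hR0 hd fun x hx =>
    hbound R hR0 (u - v) x (hball x (Metric.sphere_subset_closedBall hx))).trans ?_
  have hs := Finset.single_le_sum (f := fun m : ℕ => (m.factorial * (A / R) / R ^ m : ℝ))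
    (fun m _ => hterm m) (Finset.mem_range.2 (Nat.lt_succ_of_le hm))
  calc m.factorial * (A / R * ‖u - v‖) / R ^ m
      = m.factorial * (A / R) / R ^ m * ‖u - v‖ := by ring
    _ ≤ _ := by gcongr; linarith


/-! ### Preparations for the perturbation argument -/

variable {Γ : Contour}

theorem cauchyMinusNorm_nonneg (Γ : Contour) : 0 ≤ Γ.cauchyMinusNorm :=
  Real.sInf_nonneg fun _ h => h.1

theorem opCInvNorm_nonneg (Γ : Contour) (G : Γ.Pt → Mat) : 0 ≤ Γ.opCInvNorm G :=
  Real.sInf_nonneg fun _ h => h.1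

theorem linf_nonneg (F : Γ.Pt → Mat) : 0 ≤ Γ.linf F := ENNReal.toReal_nonneg

/-- A linear map on a finite dimensional space is continuous. The constant depends on `X`, which is
harmless for fixed `n`. -/
theorem exists_eLpNorm_boundaryValue_sub_le (left : Bool) (X : Submodule ℂ Γ.L2)
    [FiniteDimensional ℂ X] (hX : ∀ u ∈ X, Γ.MemSobolev 2 1 u) :
    ∃ C, 0 ≤ C ∧ ∀ u ∈ X, ∀ v ∈ X, eLpNorm
      (fun p => Γ.boundaryValue left (fun z => 1 + Γ.cauchy u z) p -
        Γ.boundaryValue left (fun z => 1 + Γ.cauchy v z) p) 2 Γ.arcLength ≤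
      ENNReal.ofReal (C * ‖u - v‖) := by
  set B := (boundaryMap left X hX).toContinuousLinearMap with hB
  refine ⟨‖B‖, B.opNorm_nonneg, fun u hu v hv => ?_⟩
  have mu := memLp_boundaryValue (hX u hu) left
  have mv := memLp_boundaryValue (hX v hv) left
  have e : (fun p => Γ.boundaryValue left (fun z => 1 + Γ.cauchy u z) p -
      Γ.boundaryValue left (fun z => 1 + Γ.cauchy v z) p) =ᵐ[Γ.arcLength]
      (B ⟨u, hu⟩ - B ⟨v, hv⟩ : Γ.L2) := by
    have h1 : B ⟨u, hu⟩ =ᵐ[Γ.arcLength] Γ.boundaryValue left (Γ.cauchy u) := coeFn_toL2 mu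
    have h2 : B ⟨v, hv⟩ =ᵐ[Γ.arcLength] Γ.boundaryValue left (Γ.cauchy v) := coeFn_toL2 mv
    filter_upwards [boundaryValue_one_add (hX u hu) left, boundaryValue_one_add (hX v hv) left,
      h1, h2, Lp.coeFn_sub (B ⟨u, hu⟩) (B ⟨v, hv⟩)] with p h3 h4 h5 h6 h7
    rw [h3, h4, h7, Pi.sub_apply, h5, h6]
    abel
  rw [eLpNorm_congr_ae e, ← ENNReal.ofReal_toReal (Lp.eLpNorm_ne_top _), ← Lp.norm_def, ← map_sub]
  exact ENNReal.ofReal_le_ofReal (B.le_opNorm _)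

theorem IsRegular.sub {k : ℕ} (hk : 1 ≤ k) {F G : Γ.Pt → Mat} (hF : Γ.IsRegular k F)
    (hG : Γ.IsRegular k G) : Γ.MemSobolev ⊤ 1 (fun p => F p - G p) ∧
      Γ.MemSobolev 2 1 (fun p => F p - G p) := by
  have e : (fun p => F p - G p) = (fun p => F p - 1) - fun p => G p - 1 := by
    funext p; simp
  rw [e]
  exact ⟨(hF.2.2.1.mono hk).sub (hG.2.2.1.mono hk), (hF.2.2.2.1.mono hk).sub (hG.2.2.2.1.mono hk)⟩

end Contour

/-! ### Stability of the discretized operator -/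

namespace NumericalMethod

variable {Γ : Contour} (M : NumericalMethod Γ)

instance (n : ℕ) : FiniteDimensional ℂ (M.X n) := M.proj_finite n

instance (n : ℕ) : FiniteDimensional ℂ (M.Y n) := M.interp_finite n

theorem memSobolev_of_mem_X {n : ℕ} {u : Γ.L2} (hu : u ∈ M.X n) : Γ.MemSobolev 2 1 u := by
  obtain ⟨f, rfl⟩ := hu
  exact (M.proj_mem n f).1

/-- `𝒞_n[G;Γ]` as a linear map `X_n → Y_n`. -/
noncomputable def linearOpCn (n : ℕ) {G : Γ.Pt → Mat}
    (hG : MemLp (fun p => G p - 1) ⊤ Γ.arcLength) : M.X n →ₗ[ℂ] M.Y n :=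
  LinearMap.codRestrict (M.Y n) (M.interp n ∘ₗ ((M.X n).subtype -
    Contour.mulRight hG ∘ₗ Contour.boundaryMap false (M.X n) fun _ => M.memSobolev_of_mem_X))
    fun _ => ⟨_, rfl⟩

variable {M}

theorem coe_linearOpCn {n : ℕ} {G : Γ.Pt → Mat} (hG : MemLp (fun p => G p - 1) ⊤ Γ.arcLength)
    (u : M.X n) : (M.linearOpCn n hG u : Γ.L2) = M.opCn n G u := rfl

theorem opCnInvertible_iff {n : ℕ} {G : Γ.Pt → Mat}
    (hG : MemLp (fun p => G p - 1) ⊤ Γ.arcLength) :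
    M.OpCnInvertible n G ↔ Function.Bijective (M.linearOpCn n hG) := by
  constructor
  · rintro ⟨-, hinj, hsurj⟩
    refine ⟨fun u v h => Subtype.ext (hinj u.2 v.2 (congrArg Subtype.val h)), fun y => ?_⟩
    obtain ⟨x, hx, hxy⟩ := hsurj y.2
    exact ⟨⟨x, hx⟩, Subtype.ext hxy⟩
  · rintro ⟨hinj, hsurj⟩
    refine ⟨fun u hu => (M.linearOpCn n hG ⟨u, hu⟩).2, fun u hu v hv h => ?_, fun y hy => ?_⟩
    · exact congrArg Subtype.val (hinj (a₁ := ⟨u, hu⟩) (a₂ := ⟨v, hv⟩) (Subtype.ext h))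
    · obtain ⟨x, hx⟩ := hsurj ⟨y, hy⟩
      exact ⟨x, x.2, congrArg Subtype.val hx⟩

theorem OpCnInvertible.exists_bound {n : ℕ} {G : Γ.Pt → Mat}
    (hG : MemLp (fun p => G p - 1) ⊤ Γ.arcLength) (h : M.OpCnInvertible n G) :
    ∃ A, 0 ≤ A ∧ ∀ u ∈ M.X n, ‖u‖ ≤ A * ‖M.opCn n G u‖ := by
  obtain ⟨K, -, hK⟩ := (M.linearOpCn n hG).exists_antilipschitzWith
    (LinearMap.ker_eq_bot.2 ((opCnInvertible_iff hG).1 h).1)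
  exact ⟨K, K.2, fun u hu => hK.le_mul_norm (map_zero _) ⟨u, hu⟩⟩

theorem OpCnInvertible.density_mem {n : ℕ} {G : Γ.Pt → Mat} (h : M.OpCnInvertible n G) :
    M.density n G ∈ M.X n :=
  Function.invFunOn_mem (h.2.2 ⟨_, rfl⟩)

theorem OpCnInvertible.opCn_density {n : ℕ} {G : Γ.Pt → Mat} (h : M.OpCnInvertible n G) :
    M.opCn n G (M.density n G) = M.interp n (Γ.toL2 fun p => G p - 1) :=
  Function.invFunOn_eq (h.2.2 ⟨_, rfl⟩)

theorem opCn_sub_opCn {F G : Γ.Pt → Mat} (hF : MemLp (fun p => F p - 1) ⊤ Γ.arcLength)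
    (hG : MemLp (fun p => G p - 1) ⊤ Γ.arcLength) (n : ℕ) (u : Γ.L2) :
    M.opCn n G u - M.opCn n F u = M.opTn n (fun p => 1 + (F p - G p)) u := by
  unfold opCn opTn
  rw [← map_sub, ← Contour.opT_sub_opT hF hG, Contour.opC, Contour.opC, sub_sub_sub_cancel_left]

theorem opCn_sub {n : ℕ} {G : Γ.Pt → Mat} (hG : MemLp (fun p => G p - 1) ⊤ Γ.arcLength)
    {u v : Γ.L2} (hu : u ∈ M.X n) (hv : v ∈ M.X n) :
    M.opCn n G (u - v) = M.opCn n G u - M.opCn n G v := by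
  have h := congrArg Subtype.val (map_sub (M.linearOpCn n hG) ⟨u, hu⟩ ⟨v, hv⟩)
  rwa [AddSubgroupClass.coe_sub, coe_linearOpCn, coe_linearOpCn, coe_linearOpCn] at h

/-- Stability of `𝒞_n[G;Γ]` and of the discrete density under perturbations of the jump. -/
theorem OpCnInvertible.perturb {n : ℕ} {F G : Γ.Pt → Mat}
    (hF : MemLp (fun p => F p - 1) ⊤ Γ.arcLength) (hG : MemLp (fun p => G p - 1) ⊤ Γ.arcLength)
    (h : M.OpCnInvertible n G) {A e : ℝ} (hA : 0 ≤ A) (he : 0 ≤ e)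
    (hbound : ∀ u ∈ M.X n, ‖u‖ ≤ A * ‖M.opCn n G u‖)
    (hT : ∀ u ∈ M.X n, ‖M.opTn n (fun p => 1 + (F p - G p)) u‖ ≤ e * ‖u‖) (hAe : A * e ≤ 1 / 2) :
    M.OpCnInvertible n F ∧ ‖M.density n F - M.density n G‖ ≤
      2 * A * (‖M.interp n (Γ.toL2 fun p => F p - G p)‖ + e * ‖M.density n G‖) := by
  have hinv : M.OpCnInvertible n F := by
    have hbij := (opCnInvertible_iff hG).1 h
    have hinj : Function.Injective (M.linearOpCn n hF) := by
      rw [← LinearMap.ker_eq_bot, LinearMap.ker_eq_bot']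
      intro u hu
      have h0 : M.opCn n F u = 0 := congrArg Subtype.val hu
      have h1 := opCn_sub_opCn (M := M) hF hG n u
      rw [h0, sub_zero] at h1
      have h2 := hbound u u.2
      rw [h1] at h2
      have h3 := h2.trans (mul_le_mul_of_nonneg_left (hT u u.2) hA)
      have h4 : A * (e * ‖(u : Γ.L2)‖) ≤ 1 / 2 * ‖(u : Γ.L2)‖ := by
        rw [← mul_assoc]; gcongr
      have h5 : ‖(u : Γ.L2)‖ ≤ 0 := by linarith
      exact Subtype.ext (norm_le_zero_iff.1 h5)
    exact (opCnInvertible_iff hF).2 ⟨hinj,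
      -- The unperturbed bijection shows that `X_n` and `Y_n` have the same dimension.
      (LinearMap.injective_iff_surjective_of_finrank_eq_finrank
        (LinearEquiv.ofBijective _ hbij).finrank_eq).1 hinj⟩
  refine ⟨hinv, ?_⟩
  have hu := hinv.density_mem
  have hv := h.density_mem
  set u := M.density n F with hudef
  set v := M.density n G with hvdef
  have i1 : MemLp (fun p => F p - 1) 2 Γ.arcLength := hF.mono_exponent le_top
  have i2 : MemLp (fun p => G p - 1) 2 Γ.arcLength := hG.mono_exponent le_top
  have e1 : M.opCn n G (u - v) = M.interp n (Γ.toL2 fun p => F p - G p) +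
      M.opTn n (fun p => 1 + (F p - G p)) u := by
    have e3 : (fun p => F p - G p) = (fun p => F p - 1) - fun p => G p - 1 := by
      funext p; simp
    have e4 := opCn_sub_opCn (M := M) hF hG n u
    rw [hinv.opCn_density] at e4
    rw [opCn_sub hG hu hv, h.opCn_density, ← e4, e3, Contour.toL2_sub i1 i2, map_sub]
    abel
  have h1 := hbound _ ((M.X n).sub_mem hu hv)
  rw [e1] at h1
  set a := ‖M.interp n (Γ.toL2 fun p => F p - G p)‖
  -- The perturbed density is traded for the unperturbed one; the resulting `A e ‖u - v‖` is
  -- absorbed on the left, which costs the factor 2.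
  have h2 : ‖u‖ ≤ ‖u - v‖ + ‖v‖ := by simpa using norm_add_le (u - v) v
  have h3 : A * ‖M.interp n (Γ.toL2 fun p => F p - G p) +
      M.opTn n (fun p => 1 + (F p - G p)) u‖ ≤ A * (a + e * ‖u‖) := by
    gcongr
    exact (norm_add_le _ _).trans (add_le_add le_rfl (hT u hu))
  have hn : 0 ≤ ‖u - v‖ := norm_nonneg _
  have h4 : A * (a + e * ‖u‖) ≤ A * a + A * e * ‖u - v‖ + A * (e * ‖v‖) := by
    have := mul_le_mul_of_nonneg_left h2 (mul_nonneg hA he)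
    linarith
  have h5 : A * e * ‖u - v‖ ≤ 1 / 2 * ‖u - v‖ := by gcongr
  linarith

theorem norm_interp_toL2_le {K : ℝ} {n : ℕ}
    (hK : ∀ f : Γ.L2, Γ.MemSobolev 2 1 f → ‖M.interp n f‖ ≤ K * Γ.linf f) {F : Γ.Pt → Mat}
    (hF : Γ.MemSobolev 2 1 F) : ‖M.interp n (Γ.toL2 F)‖ ≤ |K| * Γ.linf F := by
  have e := Contour.coeFn_toL2 hF.memLp
  have h1 := hK _ (hF.congr e.symm)
  rw [Contour.linf, eLpNorm_congr_ae e] at h1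
  exact h1.trans (mul_le_mul_of_nonneg_right (le_abs_self K) ENNReal.toReal_nonneg)

end NumericalMethod

/-! ### Explicit constants and powers of `n` -/

namespace NumericalMethod

variable {Γ : Contour} {M : NumericalMethod Γ}

theorem one_add_sub_one (F G : Γ.Pt → Mat) :
    (fun p => (1 + (F p - G p)) - 1) = fun p => F p - G p := by
  funext p; simp

/-- One constant serves two purposes: its second summand gives the smallness needed for
invertibility, its third the error estimate; the summand 1 keeps it positive. -/
theorem perturbation_constants {n β γ A₂ κ C₃ m K g δ A e : ℝ} (hn : 0 < n) (hA₂ : 0 ≤ A₂)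
    (hκ : 0 ≤ κ) (hC₃ : 0 ≤ C₃) (hm : 0 ≤ m) (hK : 0 ≤ K) (hg : 0 ≤ g) (hδ : 0 ≤ δ)
    (hA : A = A₂ * n ^ β * κ) (he : e = C₃ * n ^ γ * (δ * m)) :
    (1 + 2 * (A₂ * κ * C₃ * m) + 2 * (A₂ * κ * K * (1 + C₃ * m * A₂ * κ * g))) * n ^ (β + γ) * δ ≤
        1 → A * e ≤ 1 / 2 := by
  intro h
  have e1 : A * e = A₂ * κ * C₃ * m * (n ^ (β + γ) * δ) := by
    rw [hA, he, Real.rpow_add hn]; ring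
  have h0 : 0 ≤ n ^ (β + γ) * δ := by positivity
  have h1 : 0 ≤ A₂ * κ * K * (1 + C₃ * m * A₂ * κ * g) * (n ^ (β + γ) * δ) := by positivity
  rw [e1]
  nlinarith

/-- The change of the right-hand side contributes `n^β δ`, the change of the operator `n^(2β+γ) δ`;
the latter power dominates as `n^β` and `n^γ` are at least 1. -/
theorem perturbation_estimate {n β γ A₂ κ C₃ m K g δ A e : ℝ} (hn : 0 < n) (hA₂ : 0 ≤ A₂)
    (hκ : 0 ≤ κ) (hC₃ : 0 ≤ C₃) (hm : 0 ≤ m) (hK : 0 ≤ K) (hδ : 0 ≤ δ)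
    (hA : A = A₂ * n ^ β * κ) (he : e = C₃ * n ^ γ * (δ * m)) (hγ : 1 ≤ n ^ γ) (hβ : 1 ≤ n ^ β) :
    2 * A * (K * δ + e * (A * (K * g))) ≤
      (1 + 2 * (A₂ * κ * C₃ * m) + 2 * (A₂ * κ * K * (1 + C₃ * m * A₂ * κ * g))) *
        n ^ (2 * β + γ) * δ := by
  have e1 : n ^ (2 * β + γ) = n ^ β * n ^ β * n ^ γ := by
    rw [two_mul, Real.rpow_add hn, Real.rpow_add hn]
  set b := n ^ β
  set c := n ^ γ
  have hbc : b ≤ b * b * c := by nlinarith [mul_le_mul hβ hγ zero_le_one (by linarith)]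
  have e2 : 2 * A * (K * δ + e * (A * (K * g))) = 2 * (A₂ * κ * K) * δ * b +
      2 * (A₂ * κ * K * (C₃ * m * A₂ * κ * g)) * (b * b * c) * δ := by
    rw [hA, he]; ring
  have h1 : 2 * (A₂ * κ * K) * δ * b ≤ 2 * (A₂ * κ * K) * δ * (b * b * c) := by gcongr
  have h2 : 0 ≤ (1 + 2 * (A₂ * κ * C₃ * m)) * (b * b * c) * δ := by positivity
  rw [e1, e2]
  linarith

theorem OpCnInvertible.perturb_of_type {n : ℕ} {F G : Γ.Pt → Mat}
    (hF : MemLp (fun p => F p - 1) ⊤ Γ.arcLength) (hG : MemLp (fun p => G p - 1) ⊤ Γ.arcLength)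
    (h : M.OpCnInvertible n G) (hn : 1 ≤ n) {β γ C₂ κ C₃ m K g δ : ℝ} (hβ : 0 ≤ β) (hγ : 0 ≤ γ)
    (hC₂ : 0 ≤ C₂) (hκ : 0 ≤ κ) (hC₃ : 0 ≤ C₃) (hm : 0 ≤ m) (hK : 0 ≤ K) (hg : 0 ≤ g) (hδ : 0 ≤ δ)
    (hb : ∀ u ∈ M.X n, ‖u‖ ≤ C₂ * (n : ℝ) ^ β * κ * ‖M.opCn n G u‖)
    (hT : ∀ u ∈ M.X n, ‖M.opTn n (fun p => 1 + (F p - G p)) u‖ ≤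
      C₃ * (n : ℝ) ^ γ * (δ * m) * ‖u‖)
    (hFG : ‖M.interp n (Γ.toL2 fun p => F p - G p)‖ ≤ K * δ)
    (hG1 : ‖M.interp n (Γ.toL2 fun p => G p - 1)‖ ≤ K * g)
    (hsmall : (1 + 2 * (C₂ * κ * C₃ * m) + 2 * (C₂ * κ * K * (1 + C₃ * m * C₂ * κ * g))) *
      (n : ℝ) ^ (β + γ) * δ ≤ 1) :
    M.OpCnInvertible n F ∧ ‖M.density n F - M.density n G‖ ≤
      (1 + 2 * (C₂ * κ * C₃ * m) + 2 * (C₂ * κ * K * (1 + C₃ * m * C₂ * κ * g))) *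
        (n : ℝ) ^ (2 * β + γ) * δ := by
  have hnr : (1 : ℝ) ≤ n := by exact_mod_cast hn
  have hn0 : (0 : ℝ) < n := by linarith
  have hA0 : 0 ≤ C₂ * (n : ℝ) ^ β * κ := by positivity
  have he0 : 0 ≤ C₃ * (n : ℝ) ^ γ * (δ * m) := by positivity
  have hAe := perturbation_constants hn0 hC₂ hκ hC₃ hm hK hg hδ rfl rfl hsmall
  obtain ⟨h1, h2⟩ := h.perturb hF hG hA0 he0 hb hT hAe
  refine ⟨h1, h2.trans (le_trans ?_ (perturbation_estimate hn0 hC₂ hκ hC₃ hm hK hδ rfl rfl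
    (Real.one_le_rpow hnr hγ) (Real.one_le_rpow hnr hβ)))⟩
  have h3 : ‖M.density n G‖ ≤ C₂ * (n : ℝ) ^ β * κ * (K * g) := by
    refine (hb _ h.density_mem).trans ?_
    rw [h.opCn_density]
    gcongr
  gcongr

end NumericalMethod

/-! ### The lemma -/

theorem mainTheorem10 (Γ : Contour) (M : NumericalMethod Γ) (k : ℕ) (hk : 1 ≤ k) (α β γ : ℝ)
    (Gs : ℝ → Γ.Pt → Mat) (G : Γ.Pt → Mat)
    (hM : M.IsAdmissible G α β γ)
    (hGs : ∀ ξ, 0 ≤ ξ → Γ.IsRegular k (Gs ξ)) (hG : Γ.IsRegular k G)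
    (hinf : Tendsto (fun ξ => eLpNorm (fun p => Gs ξ p - G p) ⊤ Γ.arcLength) atTop (𝓝 0))
    (htwo : Tendsto (fun ξ => eLpNorm (fun p => Gs ξ p - G p) 2 Γ.arcLength) atTop (𝓝 0)) :
    (∀ n : ℕ, 1 ≤ n → M.OpCnInvertible n G →
      (∃ T > 0, ∀ ξ > T, M.OpCnInvertible n (Gs ξ)) ∧
      Tendsto (fun ξ => ‖M.density n (Gs ξ) - M.density n G‖) atTop (𝓝 0) ∧
      (∀ left : Bool, Tendsto (fun ξ => eLpNorm
        (fun p => Γ.boundaryValue left (M.approxSolution n (Gs ξ)) p -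
          Γ.boundaryValue left (M.approxSolution n G) p) 2 Γ.arcLength) atTop (𝓝 0)) ∧
      (∀ (j : ℕ) (S : Set ℂ), Γ.BoundedAway S → Tendsto (fun ξ => wInfNorm j S
        (fun z => M.approxSolution n (Gs ξ) z - M.approxSolution n G z)) atTop (𝓝 0))) ∧
    (Γ.OpCInvertible G → ∃ N : ℕ, (∀ n > N, M.OpCnInvertible n G) ∧ ∃ C > 0,
      (∀ n > N, ∀ ξ, 0 ≤ ξ →
        C * (n : ℝ) ^ (β + γ) * Γ.linf (fun p => Gs ξ p - G p) ≤ 1 →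
          M.OpCnInvertible n (Gs ξ) ∧
          ‖M.density n (Gs ξ) - M.density n G‖ ≤
            C * (n : ℝ) ^ (2 * β + γ) * Γ.linf (fun p => Gs ξ p - G p)) ∧
      ∀ (j : ℕ) (S : Set ℂ), Γ.BoundedAway S → ∃ C' > 0, ∀ n > N, ∀ ξ, 0 ≤ ξ →
        C * (n : ℝ) ^ (β + γ) * Γ.linf (fun p => Gs ξ p - G p) ≤ 1 →
          wInfNorm j S (fun z => M.approxSolution n (Gs ξ) z - M.approxSolution n G z) ≤
            ENNReal.ofReal (C' * (n : ℝ) ^ (2 * β + γ) *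
              Γ.linf (fun p => Gs ξ p - G p))) := by
  obtain ⟨⟨hα, hβ, hγ, C₁, hC₁, C₂, hC₂, C₃, hC₃, hbd, hstab⟩, -, K, hK⟩ := hM
  have hm := Γ.cauchyMinusNorm_nonneg
  -- From here on the norm of `𝒞⁻` is merely some nonnegative number.
  generalize Γ.cauchyMinusNorm = m at hbd hm
  have hGi : MemLp (fun p => G p - 1) ⊤ Γ.arcLength := hG.2.2.1.memLp
  have hGsi : ∀ ξ, 0 ≤ ξ → MemLp (fun p => Gs ξ p - 1) ⊤ Γ.arcLength :=
    fun ξ hξ => (hGs ξ hξ).2.2.1.memLp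
  have hδ0 : ∀ ξ, 0 ≤ Γ.linf fun p => Gs ξ p - G p := fun ξ => Contour.linf_nonneg _
  have hδ : Tendsto (fun ξ => Γ.linf fun p => Gs ξ p - G p) atTop (𝓝 0) := by
    simpa [Contour.linf, Function.comp_def] using
      (ENNReal.tendsto_toReal ENNReal.zero_ne_top).comp hinf
  have hT : ∀ n : ℕ, 1 ≤ n → ∀ ξ, 0 ≤ ξ → ∀ u ∈ M.X n,
      ‖M.opTn n (fun p => 1 + (Gs ξ p - G p)) u‖ ≤
        C₃ * (n : ℝ) ^ γ * ((Γ.linf fun p => Gs ξ p - G p) * m) * ‖u‖ := fun n hn ξ hξ u hu => by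
    obtain ⟨h1, h2⟩ := (hGs ξ hξ).sub hk hG
    have := (hbd n hn (fun p => 1 + (Gs ξ p - G p)) (by rwa [NumericalMethod.one_add_sub_one])
      (by rwa [NumericalMethod.one_add_sub_one])).2 u hu
    rwa [NumericalMethod.one_add_sub_one] at this
  have hI : ∀ n : ℕ, 1 ≤ n → ∀ ξ, 0 ≤ ξ → ‖M.interp n (Γ.toL2 fun p => Gs ξ p - G p)‖ ≤
      |K| * Γ.linf fun p => Gs ξ p - G p := fun n hn ξ hξ =>
    NumericalMethod.norm_interp_toL2_le (hK n hn) ((hGs ξ hξ).sub hk hG).2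
  refine ⟨fun n hn hinv => ?_, fun hopC => ?_⟩
  -- For fixed `n` any inverse bound will do, since `e ξ` tends to 0.
  · obtain ⟨A, hA, hAb⟩ := hinv.exists_bound hGi
    set e : ℝ → ℝ := fun ξ => C₃ * (n : ℝ) ^ γ * ((Γ.linf fun p => Gs ξ p - G p) * m) with he
    have he0 : ∀ ξ, 0 ≤ e ξ := fun ξ => by have := hδ0 ξ; positivity
    have helim : Tendsto e atTop (𝓝 0) := by
      simpa [he] using (hδ.mul_const m).const_mul (C₃ * (n : ℝ) ^ γ)
    have hsmall : ∀ᶠ ξ in atTop, A * e ξ ≤ 1 / 2 := by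
      have h1 : Tendsto (fun ξ => A * e ξ) atTop (𝓝 0) := by simpa using helim.const_mul A
      exact h1.eventually_le_const one_half_pos
    have hpert : ∀ᶠ ξ in atTop, M.OpCnInvertible n (Gs ξ) ∧
        ‖M.density n (Gs ξ) - M.density n G‖ ≤
          2 * A * (|K| * (Γ.linf fun p => Gs ξ p - G p) + e ξ * ‖M.density n G‖) := by
      filter_upwards [hsmall, eventually_ge_atTop 0] with ξ h1 hξ
      obtain ⟨h2, h3⟩ := hinv.perturb (hGsi ξ hξ) hGi hA (he0 ξ) hAb (hT n hn ξ hξ) h1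
      refine ⟨h2, h3.trans ?_⟩
      gcongr
      exact hI n hn ξ hξ
    have hdens : Tendsto (fun ξ => ‖M.density n (Gs ξ) - M.density n G‖) atTop (𝓝 0) := by
      refine squeeze_zero' (Eventually.of_forall fun ξ => norm_nonneg _)
        (hpert.mono fun ξ h => h.2) ?_
      simpa using ((hδ.const_mul |K|).add (helim.mul_const ‖M.density n G‖)).const_mul (2 * A)
    have hsq : ∀ C : ℝ, Tendsto (fun ξ => ENNReal.ofReal
        (C * ‖M.density n (Gs ξ) - M.density n G‖)) atTop (𝓝 0) := fun C => by
      simpa using ENNReal.tendsto_ofReal (hdens.const_mul C)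
    refine ⟨?_, hdens, fun left => ?_, fun j S hS => ?_⟩
    · obtain ⟨T, hTT⟩ := eventually_atTop.1 hpert
      exact ⟨max T 1, by positivity, fun ξ hξ => (hTT ξ ((le_max_left _ _).trans hξ.le)).1⟩
    · obtain ⟨C, -, hC⟩ := Contour.exists_eLpNorm_boundaryValue_sub_le left (M.X n)
        fun _ => M.memSobolev_of_mem_X
      exact tendsto_of_tendsto_of_tendsto_of_le_of_le' tendsto_const_nhds (hsq C)
        (Eventually.of_forall fun ξ => zero_le)
        (hpert.mono fun ξ h => hC _ h.1.density_mem _ hinv.density_mem)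
    · obtain ⟨C, -, hC⟩ := Contour.exists_wInfNorm_sub_le j hS
      exact tendsto_of_tendsto_of_tendsto_of_le_of_le tendsto_const_nhds (hsq C)
        (fun ξ => zero_le) fun ξ => hC _ _
  · obtain ⟨N, hN⟩ := hstab hopC
    have hκ := Γ.opCInvNorm_nonneg G
    generalize Γ.opCInvNorm G = κ at hN hκ
    have hg : 0 ≤ Γ.linf fun p => G p - 1 := Contour.linf_nonneg _
    obtain ⟨g, hgdef⟩ : ∃ g, g = Γ.linf fun p => G p - 1 := ⟨_, rfl⟩
    rw [← hgdef] at hg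
    obtain ⟨C, hC⟩ : ∃ C, C =
        1 + 2 * (C₂ * κ * C₃ * m) + 2 * (C₂ * κ * |K| * (1 + C₃ * m * C₂ * κ * g)) := ⟨_, rfl⟩
    have hC0 : 0 < C := by rw [hC]; positivity
    have main : ∀ n > N, ∀ ξ, 0 ≤ ξ →
        C * (n : ℝ) ^ (β + γ) * Γ.linf (fun p => Gs ξ p - G p) ≤ 1 →
          M.OpCnInvertible n (Gs ξ) ∧ ‖M.density n (Gs ξ) - M.density n G‖ ≤
            C * (n : ℝ) ^ (2 * β + γ) * Γ.linf (fun p => Gs ξ p - G p) := by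
      intro n hn ξ hξ hsmall
      have hn1 : 1 ≤ n := by omega
      rw [hC] at hsmall ⊢
      have hG1 := NumericalMethod.norm_interp_toL2_le (hK n hn1) (hG.2.2.2.1.mono hk)
      rw [← hgdef] at hG1
      exact (hN n hn).1.perturb_of_type (hGsi ξ hξ) hGi hn1 hβ hγ hC₂.le hκ hC₃.le hm (abs_nonneg K)
        hg (hδ0 ξ) (hN n hn).2 (hT n hn1 ξ hξ) (hI n hn1 ξ hξ) hG1 hsmall
    refine ⟨N, fun n hn => (hN n hn).1, C, hC0, main, fun j S hS => ?_⟩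
    obtain ⟨D, hD, hDb⟩ := Contour.exists_wInfNorm_sub_le j hS
    -- `D` depends only on `j`, `S` and the contour, so the bound off `Γ` inherits the rate of the
    -- densities.
    refine ⟨D * C, by positivity, fun n hn ξ hξ hsmall => (hDb _ _).trans
      (ENNReal.ofReal_le_ofReal ?_)⟩
    rw [mul_assoc D, mul_assoc D]
    gcongr
    exact (main n hn ξ hξ hsmall).2
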